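/- **Data.** Let $K\ge 1$ be an integer, $\Delta t>0$, $T=K\Delta t$, $\mathcal T=[0,T]$, $\mathcal K=\{1,\dots,K\}$, $\mathcal T_k=[(k-1)\Delta t,k\Delta t)$ for $k<K$ and $\mathcal T_K=[T-\Delta t,T]$. Let $\underline x\le 0\le\bar x$, $0\le\underline y\le\bar y$, $\eta^{\mathrm c},\eta^{\mathrm d}\in(0,1)$, $\Delta\eta=1/\eta^{\mathrm d}-\eta^{\mathrm c}$. Let the budget $\gamma\in[0,T]$ be a positive integer multiple of $\Delta t$, and let the initial state of charge satisfy $y_0\ge\underline y$. Write $[z]^+=\max\{z,0\}$, $[z]^-=\max\{-z,0\}$. Let $\mathcal F(\mathcal T,U)$ be the set of functions $\mathcal T\to U$ that are constant on each $\mathcal T_k$, and let $c(x^0,x^\uparrow,x^\downarrow)$ and $\phi(x^0,x^\uparrow,x^\downarrow,y_0)$ be arbitrary extended-real-valued functions of $x^0\in\mathcal F(\mathcal T,\mathbb R)$, $x^\uparrow,x^\downarrow\in\mathcal F(\mathcal T,\mathbb R_+)$. Let $\Xi$ be the set of Riemann integrable $\xi:\mathcal T\to[-1,1]$ with $\int_{\mathcal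 T}|\xi(t)|\,dt\le\gamma$. Put $$x_\xi(t)=x^0(t)+[\xi(t)]^+x^\uparrow(t)-[\xi(t)]^-x^\downarrow(t),\qquad y_\xi(t)=y_0+\int_0^t\Big(\eta^{\mathrm c}[x_\xi(\tau)]^--\tfrac1{\eta^{\mathrm d}}[x_\xi(\tau)]^+\Big)d\tau .$$ **Problem (R).** Minimize $c(x^0,x^\uparrow,x^\downarrow)+\phi(x^0,x^\uparrow,x^\downarrow,y_0)$ over $x^0\in\mathcal F(\mathcal T,\mathbb R)$, $x^\uparrow,x^\downarrow\in\mathcal F(\mathcal T,\mathbb R_+)$ subject to $\underline x\le x_\xi(t)\le\bar x$ and $\underline y\le y_\xi(t)\le\bar y$ for all $t\in\mathcal T$ and all $\xi\in\Xi$. **Problem (P).** Identify piecewise constant functions with the vectors of their values (equivalently, averages) on the intervals $\mathcal T_k$. Minimize the same objective over $\boldsymbol x^0\in\mathbb R^K$, $\boldsymbol x^\uparrow,\boldsymbol x^\downarrow\in\mathbb R^K_+$, $\boldsymbol\alpha,\boldsymbol\beta\in\mathbb R^K$, $\underline{\boldsymbol\lambda},\bar{\boldsymbol\lambda}\in\mathbb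 R^K_+$, $\underline{\boldsymbol\Lambda}_k\in\mathbb R^k_+$, $\bar{\boldsymbol\Lambda}_k\in\mathbb R^k$ ($k\in\mathcal K$), $\upsilon_{1k},\upsilon_{2k}\in\{0,1\}$ ($k<K$), subject to: *Power output*, for all $k\in\mathcal K$: $x^0_k+x^\uparrow_k\le\bar x$ and $x^0_k-x^\downarrow_k\ge\underline x$. *Lower SOC*, for all $k\in\mathcal K$ and $l\le k$: $$y_0-\gamma\underline\lambda_k-\Delta t\sum_{l\le k}(\alpha_l+\underline\Lambda_{kl})\ge\underline y,\qquad \underline\Lambda_{kl}+\underline\lambda_k+\alpha_l-\beta_l\ge0,$$ $$\alpha_k\ge\eta^{\mathrm c}x^0_k,\quad \alpha_k\ge\frac{x^0_k}{\eta^{\mathrm d}},\quad \beta_k\ge\eta^{\mathrm c}(x^0_k+x^\uparrow_k),\quad \beta_k\ge\frac{x^0_k+x^\uparrow_k}{\eta^{\mathrm d}}.$$ *Upper SOC*, for all $k\in\mathcal K$: $$y_0+\gamma\bar\lambda_k+\Delta t\sum_{l\le k}\bar\Lambda_{kl}\le\bar y,\quad \bar\Lambda_{kk}\ge-\eta^{\mathrm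 c}x^0_k,\quad \bar\Lambda_{kk}\ge\eta^{\mathrm c}(x^\downarrow_k-x^0_k)-\bar\lambda_k,\quad \bar\Lambda_{kk}\ge0;$$ for all $k<K$: $$(1-\upsilon_{1k})\underline x\le x^0_k-x^\downarrow_k\le\upsilon_{1k}\bar x,\qquad \upsilon_{2k}\underline x\le x^0_k\le(1-\upsilon_{2k})\bar x;$$ and for all $k,l\in\mathcal K$ with $l<k$: $$\bar\Lambda_{kl}\ge\frac{x^\downarrow_l-x^0_l}{\eta^{\mathrm d}}-\bar\lambda_k+(1-\upsilon_{1l})\Delta\eta\,\underline x,\qquad \bar\Lambda_{kl}\ge-\frac{x^0_l}{\eta^{\mathrm d}}+\upsilon_{2l}\Delta\eta\,\underline x,$$ $$\bar\Lambda_{kl}\ge\eta^{\mathrm c}(x^\downarrow_l-x^0_l)-\bar\lambda_k-\upsilon_{1l}\Delta\eta\,\bar x,\qquad \bar\Lambda_{kl}\ge-\eta^{\mathrm c}x^0_l-(1-\upsilon_{2l})\Delta\eta\,\bar x,$$ $$\bar\Lambda_{kl}x^\downarrow_l+\bar\lambda_kx^0_l\ge\upsilon_{2l}\frac{\underline x(\bar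 x-\underline x)}{\eta^{\mathrm d}}-\upsilon_{1l}\frac{\bar x^2}{4\eta^{\mathrm d}}.$$ **Theorem.** Problems (R) and (P) are equivalent: the identification of piecewise constant functions with vectors is a bijection; $(x^0,x^\uparrow,x^\downarrow)$ is feasible in (R) if and only if $(\boldsymbol x^0,\boldsymbol x^\uparrow,\boldsymbol x^\downarrow)$ can be completed by auxiliary variables to a feasible point of (P), and this remains true if $\bar\lambda_k\le(\bar x-\underline x)/\eta^{\mathrm d}$ is required in addition for all $k$; the objective values of corresponding points agree; the two optimal values are equal; a feasible point of (P) is optimal in (P) if and only if its bids are optimal in (R); and every optimal solution of (R) arises from an optimal solution of (P). -/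

import Mathlib

open scoped NNReal

noncomputable section

/-- Riemann integrability (Darboux form) of a function on `[a, b]`: for every `ε > 0` there are a
partition `a = p 0 ≤ … ≤ p n = b` and bounds `m i ≤ f ≤ M i` on its closed cells such that the
upper sum exceeds the lower sum by less than `ε`. -/
def RiemannIntegrable {a b : ℝ} (f : Set.Icc a b → ℝ) : Prop :=
  ∀ ε : ℝ, 0 < ε → ∃ (n : ℕ) (p m M : ℕ → ℝ),
    Monotone p ∧ p 0 = a ∧ p n = b ∧
    (∀ i < n, ∀ t : Set.Icc a b, p i ≤ (t : ℝ) → (t : ℝ) ≤ p (i + 1) → m i ≤ f t ∧ f t ≤ M i) ∧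
    ∑ i ∈ Finset.range n, (M i - m i) * (p (i + 1) - p i) < ε

/-- A minimization problem over variables in `V` with extended-real objective. -/
structure OptProblem (V : Type*) where
  feasible : Set V
  cost : V → EReal

/-- Optimal value (`⊤` for an infeasible problem). -/
def OptProblem.value {V : Type*} (Q : OptProblem V) : EReal :=
  ⨅ z ∈ Q.feasible, Q.cost z

/-- `z` is an optimal solution (minimizer). -/
def OptProblem.IsOptimal {V : Type*} (Q : OptProblem V) (z : V) : Prop :=
  z ∈ Q.feasible ∧ ∀ z' ∈ Q.feasible, Q.cost z ≤ Q.cost z'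

/-- The parameters of the storage bidding problem, with their ranges. -/
structure StorageData where
  /-- number of trading intervals -/
  K : ℕ
  /-- length of a trading interval -/
  dt : ℝ
  /-- deviation time budget -/
  γ : ℝ
  /-- lower bound on the power output -/
  xlo : ℝ
  /-- upper bound on the power output -/
  xhi : ℝ
  /-- lower bound on the state of charge -/
  ylo : ℝ
  /-- upper bound on the state of charge -/
  yhi : ℝ
  /-- charging efficiency -/
  etaC : ℝ
  /-- discharging efficiency -/
  etaD : ℝ
  /-- initial state of charge -/
  y0 : ℝ
  K_pos : 0 < K
  dt_pos : 0 < dt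
  γ_nonneg : 0 ≤ γ
  γ_le : γ ≤ K * dt
  xlo_nonpos : xlo ≤ 0
  xhi_nonneg : 0 ≤ xhi
  ylo_nonneg : 0 ≤ ylo
  ylo_le_yhi : ylo ≤ yhi
  etaC_pos : 0 < etaC
  etaC_lt_one : etaC < 1
  etaD_pos : 0 < etaD
  etaD_lt_one : etaD < 1
  y0_nonneg : 0 ≤ y0

namespace StorageData

variable (D : StorageData)

/-- The planning horizon `[0, T]`, `T = K Δt`. -/
abbrev Horizon : Type := Set.Icc (0 : ℝ) (D.K * D.dt)

/-- Lebesgue measure on the planning horizon. -/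
def leb : MeasureTheory.Measure D.Horizon := MeasureTheory.volume.comap Subtype.val

/-- The trading intervals, indexed from `0`: `[k Δt, (k+1) Δt)`, the last one closed on the
right. -/
def interval (k : Fin D.K) : Set D.Horizon :=
  {t | (k : ℝ) * D.dt ≤ (t : ℝ) ∧ ((t : ℝ) < ((k : ℝ) + 1) * D.dt ∨ (k : ℕ) + 1 = D.K)}

/-- The functions `[0, T] → U` that are constant on each trading interval. -/
def PiecewiseConst (U : Type) : Type :=
  {f : D.Horizon → U // ∀ k : Fin D.K, ∀ s ∈ D.interval k, ∀ t ∈ D.interval k, f s = f t}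

/-- The index of the trading interval that contains `t`. -/
def idx (t : D.Horizon) : Fin D.K :=
  ⟨min ⌊(t : ℝ) / D.dt⌋₊ (D.K - 1), by have := D.K_pos; omega⟩

theorem idx_eq_of_mem {k : Fin D.K} {t : D.Horizon} (ht : t ∈ D.interval k) : D.idx t = k := by
  have hdt := D.dt_pos
  have hk := k.isLt
  have hle : (k : ℕ) ≤ ⌊(t : ℝ) / D.dt⌋₊ :=
    Nat.le_floor ((le_div_iff₀ hdt).mpr ht.1)
  apply Fin.ext
  change min ⌊(t : ℝ) / D.dt⌋₊ (D.K - 1) = (k : ℕ)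
  rcases ht.2 with h | h
  · have hlt : ⌊(t : ℝ) / D.dt⌋₊ < (k : ℕ) + 1 := by
      rw [Nat.floor_lt (div_nonneg t.2.1 hdt.le), div_lt_iff₀ hdt]
      push_cast
      exact h
    omega
  · omega

/-- The step function with value `v k` on the `k`-th trading interval. -/
def step {U : Type} (v : Fin D.K → U) : D.PiecewiseConst U :=
  ⟨fun t => v (D.idx t), fun k s hs t ht => by
    change v (D.idx s) = v (D.idx t)
    rw [D.idx_eq_of_mem hs, D.idx_eq_of_mem ht]⟩

/-- Average of a function over the `k`-th trading interval. -/
def avg (w : D.Horizon → ℝ) (k : Fin D.K) : ℝ :=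
  (1 / D.dt) * ∫ τ in D.interval k, w τ ∂D.leb

/-- Market decisions as functions of time: arbitrage `x0`, upregulation `xu`, downregulation
`xd`. -/
structure Bids where
  x0 : D.PiecewiseConst ℝ
  xu : D.PiecewiseConst ℝ≥0
  xd : D.PiecewiseConst ℝ≥0

/-- Power output for given arbitrage, up- and downregulation and signal values. -/
def power (x0 xu xd ξ : ℝ) : ℝ := x0 + ξ⁺ * xu - ξ⁻ * xd

/-- Power output of the bids `x` at time `t` under the regulation signal `ξ`. -/
def output (x : D.Bids) (ξ : D.Horizon → ℝ) (t : D.Horizon) : ℝ :=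
  power (x.x0.1 t) (x.xu.1 t) (x.xd.1 t) (ξ t)

/-- State of charge at time `t`. -/
def soc (x : D.Bids) (ξ : D.Horizon → ℝ) (t : D.Horizon) : ℝ :=
  D.y0 + ∫ τ in Set.Iic t, (D.etaC * (D.output x ξ τ)⁻ - (1 / D.etaD) * (D.output x ξ τ)⁺) ∂D.leb

/-- The functional uncertainty set of regulation signals. -/
def signals : Set (D.Horizon → ℝ) :=
  {ξ | RiemannIntegrable ξ ∧ (∀ t, ξ t ∈ Set.Icc (-1 : ℝ) 1) ∧ ∫ t, |ξ t| ∂D.leb ≤ D.γ}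

/-- The robust continuous-time bidding problem (R), with cost `c` and cost-to-go `φ`. -/
def robustProblem (c : D.Bids → EReal) (φ : D.Bids → ℝ → EReal) : OptProblem D.Bids where
  feasible := {x | ∀ t : D.Horizon, ∀ ξ ∈ D.signals,
    D.xlo ≤ D.output x ξ t ∧ D.output x ξ t ≤ D.xhi ∧
    D.ylo ≤ D.soc x ξ t ∧ D.soc x ξ t ≤ D.yhi}
  cost x := c x + φ x D.y0

/-- Market decisions as vectors. -/
structure BidVec where
  x0 : Fin D.K → ℝ
  xu : Fin D.K → ℝ≥0
  xd : Fin D.K → ℝ≥0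

/-- The piecewise constant bids with the given values on the trading intervals. -/
def lift (v : D.BidVec) : D.Bids := ⟨D.step v.x0, D.step v.xu, D.step v.xd⟩

/-- Index of a trading interval that is not the last one. -/
abbrev NonLast : Type := {k : Fin D.K // (k : ℕ) + 1 < D.K}

variable {D} in
/-- An interval with a later one is not the last one. -/
def nonLast {l k : Fin D.K} (h : l < k) : D.NonLast :=
  ⟨l, by have := k.isLt; have : (l : ℕ) < k := h; omega⟩

/-- The variables of the finite-dimensional problem. `LamLo k` and `LamHi k` have one entry for
each interval `l ≤ k`. -/
structure ProgVar where
  bids : D.BidVec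
  α : Fin D.K → ℝ
  β : Fin D.K → ℝ
  lamLo : Fin D.K → ℝ
  lamHi : Fin D.K → ℝ
  LamLo : (k : Fin D.K) → Set.Iic k → ℝ
  LamHi : (k : Fin D.K) → Set.Iic k → ℝ
  υ₁ : D.NonLast → ℝ
  υ₂ : D.NonLast → ℝ

/-- Specific loss. -/
def deltaEta : ℝ := 1 / D.etaD - D.etaC

/-- Domains of the auxiliary variables. -/
structure Domains (z : D.ProgVar) : Prop where
  lamLo_nonneg : ∀ k, 0 ≤ z.lamLo k
  lamHi_nonneg : ∀ k, 0 ≤ z.lamHi k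
  LamLo_nonneg : ∀ k l, 0 ≤ z.LamLo k l
  υ₁_binary : ∀ k, z.υ₁ k = 0 ∨ z.υ₁ k = 1
  υ₂_binary : ∀ k, z.υ₂ k = 0 ∨ z.υ₂ k = 1

/-- Power-output constraints. -/
structure PowerCons (z : D.ProgVar) : Prop where
  upper : ∀ k, z.bids.x0 k + z.bids.xu k ≤ D.xhi
  lower : ∀ k, D.xlo ≤ z.bids.x0 k - z.bids.xd k

/-- Lower-SOC constraints. -/
structure LowerSOC (z : D.ProgVar) : Prop where
  soc : ∀ k, D.ylo ≤
    D.y0 - D.γ * z.lamLo k - D.dt * ∑ l : Set.Iic k, (z.α l + z.LamLo k l)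
  α_charge : ∀ k, D.etaC * z.bids.x0 k ≤ z.α k
  α_discharge : ∀ k, z.bids.x0 k / D.etaD ≤ z.α k
  β_charge : ∀ k, D.etaC * (z.bids.x0 k + z.bids.xu k) ≤ z.β k
  β_discharge : ∀ k, (z.bids.x0 k + z.bids.xu k) / D.etaD ≤ z.β k
  dual : ∀ k, ∀ l : Set.Iic k, 0 ≤ z.LamLo k l + z.lamLo k + z.α l - z.β l

/-- Upper-SOC constraints. -/
structure UpperSOC (z : D.ProgVar) : Prop where
  soc : ∀ k, D.y0 + D.γ * z.lamHi k + D.dt * ∑ l : Set.Iic k, z.LamHi k l ≤ D.yhi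
  diag_charge : ∀ k, -D.etaC * z.bids.x0 k ≤ z.LamHi k ⟨k, le_refl k⟩
  diag_down : ∀ k,
    D.etaC * (z.bids.xd k - z.bids.x0 k) - z.lamHi k ≤ z.LamHi k ⟨k, le_refl k⟩
  diag_nonneg : ∀ k, 0 ≤ z.LamHi k ⟨k, le_refl k⟩
  υ₁_lower : ∀ k : D.NonLast, (1 - z.υ₁ k) * D.xlo ≤ z.bids.x0 k - z.bids.xd k
  υ₁_upper : ∀ k : D.NonLast, z.bids.x0 k - z.bids.xd k ≤ z.υ₁ k * D.xhi
  υ₂_lower : ∀ k : D.NonLast, z.υ₂ k * D.xlo ≤ z.bids.x0 k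
  υ₂_upper : ∀ k : D.NonLast, z.bids.x0 k ≤ (1 - z.υ₂ k) * D.xhi
  off_diag₁ : ∀ (k l : Fin D.K) (h : l < k),
    (z.bids.xd l - z.bids.x0 l) / D.etaD - z.lamHi k
      + (1 - z.υ₁ (nonLast h)) * D.deltaEta * D.xlo ≤ z.LamHi k ⟨l, le_of_lt h⟩
  off_diag₂ : ∀ (k l : Fin D.K) (h : l < k),
    -(z.bids.x0 l / D.etaD) + z.υ₂ (nonLast h) * D.deltaEta * D.xlo
      ≤ z.LamHi k ⟨l, le_of_lt h⟩
  off_diag₃ : ∀ (k l : Fin D.K) (h : l < k),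
    D.etaC * (z.bids.xd l - z.bids.x0 l) - z.lamHi k
      - z.υ₁ (nonLast h) * D.deltaEta * D.xhi ≤ z.LamHi k ⟨l, le_of_lt h⟩
  off_diag₄ : ∀ (k l : Fin D.K) (h : l < k),
    -D.etaC * z.bids.x0 l - (1 - z.υ₂ (nonLast h)) * D.deltaEta * D.xhi
      ≤ z.LamHi k ⟨l, le_of_lt h⟩
  bilinear : ∀ (k l : Fin D.K) (h : l < k),
    z.υ₂ (nonLast h) * (D.xlo * (D.xhi - D.xlo) / D.etaD)
      - z.υ₁ (nonLast h) * (D.xhi ^ 2 / (4 * D.etaD))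
      ≤ z.LamHi k ⟨l, le_of_lt h⟩ * z.bids.xd l + z.lamHi k * z.bids.x0 l

/-- The finite-dimensional mixed-binary bilinear problem (P). The cost functions are evaluated at
bid vectors through the identification of vectors with piecewise constant functions. -/
def finiteProblem (c : D.Bids → EReal) (φ : D.Bids → ℝ → EReal) : OptProblem D.ProgVar where
  feasible := {z | D.Domains z ∧ D.PowerCons z ∧ D.LowerSOC z ∧ D.UpperSOC z}
  cost z := c (D.lift z.bids) + φ (D.lift z.bids) D.y0

end StorageData

end

/-!
The rate of change of the state of charge is a function `rate` of the power output that is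
decreasing, concave and positively homogeneous, being the minimum of `-etaC * p` and `-p / etaD`.
Hence only pure upregulation is critical for the lower bound on the state of charge and only pure
downregulation for the upper bound. The dependence on a signal is through a pointwise function of
its value and the single coupling constraint `∫ |ξ| ≤ γ`, which is dualized by one multiplier per
trading interval.

*Lower bound.* Along pure upregulation the worst case of a concave function on `[0, 1]` is
bang-bang, so that the constraint at the end of an interval is about sets of at most `n = γ / Δt`
intervals with full upregulation. By `exists_threshold`, the best such set among the intervals
before `k` and the best one among the intervals up to `k` share an optimal multiplier, the `n`-th
largest gain. This gives the dual variables (`exists_lower_multiplier`), and it makes the worst-case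
state of charge affine in time within an interval, so that instants inside an interval impose
nothing new (`le_soc_of_finite`). This is where `γ` has to be a positive multiple of `Δt`.

*Upper bound.* The worst case is here a concave maximization, and instants inside an interval do
matter. By positive homogeneity, running for a fraction `τ` of the interval with total deviation
`σ` contributes `rate (τ * x0 - σ * xd)`, which is jointly concave in `(τ, σ)`. Strong duality for
a separable concave problem with one linear constraint (`exists_separable_multipliers`) yields the
multipliers, bounded by the Lipschitz constant `(xhi - xlo) / etaD`. What is left is that an affine
function majorizes `s ↦ rate (x0 - s * xd)` on `[0, 1]` exactly if it does so at `0`, `1` and, if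
it lies in between, the kink `x0 / xd`; the binary variables select the case and the bilinear
constraint is the condition at the kink (`bilinear_of_majorant`, `majorant_of_constraints`).

Signals in (R) are probed by step signals that are cut off at the instant considered. Conversely,
the pointwise affine bounds are integrated, for which Riemann integrable functions have to be
almost everywhere measurable (`RiemannIntegrable.aemeasurable`).
-/

open MeasureTheory

/-! ### Riemann integrable functions -/

/-- A function with values in `[-1, 1]` that is constant on the intervals that avoid a finite set
is Riemann integrable: on a uniform partition, boundedly many cells contribute. -/
theorem RiemannIntegrable.of_const_off_finset {a b : ℝ} (hab : a < b) (f : Set.Icc a b → ℝ)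
    (F : Finset ℝ) (hf : ∀ t, f t ∈ Set.Icc (-1 : ℝ) 1)
    (hF : ∀ s t : Set.Icc a b, s ≤ t → (∀ x ∈ F, ¬ ((s : ℝ) ≤ x ∧ x ≤ t)) → f s = f t) :
    RiemannIntegrable f := by
  classical
  intro ε hε
  obtain ⟨N, hN⟩ := exists_nat_gt (4 * F.card * (b - a) / ε)
  have hba : 0 < b - a := sub_pos.2 hab
  have hN0 : (0 : ℝ) < N := lt_of_le_of_lt (by positivity) hN
  obtain ⟨h, hh⟩ : ∃ h : ℝ, h = (b - a) / N := ⟨_, rfl⟩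
  have hpos : 0 < h := by rw [hh]; positivity
  have hNh : N * h = b - a := by rw [hh]; field_simp
  let p : ℕ → ℝ := fun i => a + i * h
  let bad : ℕ → Prop := fun i => ∃ x ∈ F, p i ≤ x ∧ x ≤ p (i + 1)
  have hstep : ∀ i, p (i + 1) - p i = h := fun i => by simp only [p]; push_cast; ring
  have hmono : Monotone p := monotone_nat_of_le_succ fun i => by linarith [hstep i]
  have hp0 : p 0 = a := by simp [p]
  have hpN : p N = b := by simp only [p]; linarith
  refine ⟨N, p, fun i => if bad i then -1 else f (Set.projIcc a b hab.le (p i)),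
    fun i => if bad i then 1 else f (Set.projIcc a b hab.le (p i)), hmono, hp0, hpN, ?_, ?_⟩
  · intro i hi t h1 h2
    by_cases hb : bad i
    · simp only [hb, if_true]
      exact hf t
    · simp only [hb, if_false]
      have hmem : p i ∈ Set.Icc a b :=
        ⟨hp0.ge.trans (hmono (Nat.zero_le i)), (hmono hi.le).trans hpN.le⟩
      rw [Set.projIcc_of_mem hab.le hmem, hF ⟨p i, hmem⟩ t h1 fun x hx hc =>
        hb ⟨x, hx, hc.1, hc.2.trans h2⟩]
      exact ⟨le_rfl, le_rfl⟩
  · -- a point of `F` lies in at most two of the closed cells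
    have hcard : ∀ x ∈ F,
        ∑ i ∈ Finset.range N, (if p i ≤ x ∧ x ≤ p (i + 1) then 2 * h else 0) ≤ 4 * h := by
      intro x _
      rw [← Finset.sum_filter, Finset.sum_const, nsmul_eq_mul]
      have hsub : (Finset.range N).filter (fun i => p i ≤ x ∧ x ≤ p (i + 1)) ⊆
          {⌊(x - a) / h⌋₊, ⌊(x - a) / h⌋₊ - 1} := by
        intro i hi
        obtain ⟨-, h1, h2⟩ := Finset.mem_filter.1 hi
        have h1' : (i : ℝ) ≤ (x - a) / h := by
          rw [le_div_iff₀ hpos]; simp only [p] at h1; linarith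
        have h2' : (x - a) / h ≤ ((i + 1 : ℕ) : ℝ) := by
          rw [div_le_iff₀ hpos]; simp only [p] at h2; linarith
        have h3 := Nat.le_floor h1'
        have h4 := Nat.floor_le_of_le h2'
        simp only [Finset.mem_insert, Finset.mem_singleton]
        omega
      have hc : (((Finset.range N).filter (fun i => p i ≤ x ∧ x ≤ p (i + 1))).card : ℝ) ≤ 2 := by
        exact_mod_cast (Finset.card_le_card hsub).trans Finset.card_le_two
      nlinarith
    calc ∑ i ∈ Finset.range N, ((if bad i then 1 else f (Set.projIcc a b hab.le (p i)))
          - (if bad i then -1 else f (Set.projIcc a b hab.le (p i)))) * (p (i + 1) - p i)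
        ≤ ∑ i ∈ Finset.range N, ∑ x ∈ F, (if p i ≤ x ∧ x ≤ p (i + 1) then 2 * h else 0) := by
          refine Finset.sum_le_sum fun i _ => ?_
          rw [hstep]
          by_cases hb : bad i
          · obtain ⟨x, hx, hc⟩ := id hb
            simp only [hb, if_true]
            refine le_trans ?_ (Finset.single_le_sum (f := fun x =>
              if p i ≤ x ∧ x ≤ p (i + 1) then 2 * h else 0) (fun y _ => ?_) hx)
            · simp only [hc, and_self, if_true]; linarith
            · split_ifs <;> linarith
          · simp only [hb, if_false, sub_self, zero_mul]
            exact Finset.sum_nonneg fun y _ => by split_ifs <;> linarith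
      _ ≤ F.card * (4 * h) := by
          rw [Finset.sum_comm, ← nsmul_eq_mul]
          exact Finset.sum_le_card_nsmul _ _ _ hcard
      _ < ε := by
          rw [div_lt_iff₀ hε] at hN
          have : F.card * (4 * h) * N = 4 * F.card * (b - a) := by rw [← hNh]; ring
          by_contra! hcon
          nlinarith

/-- A function that lies between measurable functions with arbitrarily small integral gap is
almost everywhere measurable: it agrees with the supremum of a sequence of lower bounds. -/
theorem aemeasurable_of_squeeze {X : Type*} [MeasurableSpace X] {μ : Measure X} {f : X → ℝ}
    (h : ∀ ε : ℝ, 0 < ε → ∃ l u : X → ℝ, Measurable l ∧ Measurable u ∧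
      (∀ᵐ x ∂μ, l x ≤ f x ∧ f x ≤ u x) ∧
      ∫⁻ x, ENNReal.ofReal (u x - l x) ∂μ ≤ ENNReal.ofReal ε) :
    AEMeasurable f μ := by
  choose! l u hl hu hlu hint using h
  have he : ∀ j : ℕ, (0 : ℝ) < 1 / ((j : ℝ) + 1) := fun j => by positivity
  let e : ℕ → ℝ := fun j => 1 / ((j : ℝ) + 1)
  have hL : Measurable fun x => ⨆ j, l (e j) x := Measurable.iSup fun j => hl _ (he j)
  have hU : Measurable fun x => ⨅ j, u (e j) x := Measurable.iInf fun j => hu _ (he j)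
  have hae : ∀ᵐ x ∂μ, ∀ j, l (e j) x ≤ f x ∧ f x ≤ u (e j) x :=
    ae_all_iff.2 fun j => hlu _ (he j)
  have hzero : ∫⁻ x, ENNReal.ofReal ((⨅ j, u (e j) x) - ⨆ j, l (e j) x) ∂μ = 0 := by
    refine le_antisymm (ge_of_tendsto' (x := Filter.atTop)
      (f := fun j : ℕ => ENNReal.ofReal (e j)) ?_ fun j => ?_) bot_le
    · simpa [e] using ENNReal.tendsto_ofReal tendsto_one_div_add_atTop_nhds_zero_nat
    · refine le_trans (lintegral_mono_ae ?_) (hint _ (he j))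
      filter_upwards [hae] with x hx
      refine ENNReal.ofReal_le_ofReal (sub_le_sub ?_ ?_)
      · exact ciInf_le ⟨f x, by rintro _ ⟨i, rfl⟩; exact (hx i).2⟩ j
      · exact le_ciSup (f := fun j => l (e j) x) ⟨f x, by rintro _ ⟨i, rfl⟩; exact (hx i).1⟩ j
  rw [lintegral_eq_zero_iff (by fun_prop)] at hzero
  refine ⟨_, hL, ?_⟩
  filter_upwards [hae, hzero] with x hx h0
  have h1 : (⨅ j, u (e j) x) - ⨆ j, l (e j) x ≤ 0 := by simpa using h0
  have h2 : f x ≤ ⨅ j, u (e j) x := le_ciInf fun i => (hx i).2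
  have h3 : ⨆ j, l (e j) x ≤ f x := ciSup_le fun i => (hx i).1
  linarith

theorem RiemannIntegrable.aemeasurable {a b : ℝ} {f : Set.Icc a b → ℝ}
    (hf : RiemannIntegrable f) : AEMeasurable f (volume.comap Subtype.val) := by
  classical
  refine aemeasurable_of_squeeze fun ε hε => ?_
  obtain ⟨n, p, m, M, hp, h0, hn, hcell, hsum⟩ := hf ε hε
  let c : ℕ → Set (Set.Icc a b) := fun i => Subtype.val ⁻¹' Set.Ioc (p i) (p (i + 1))
  have hc : ∀ i, MeasurableSet (c i) := fun i => measurable_subtype_coe measurableSet_Ioc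
  let stepFn : (ℕ → ℝ) → Set.Icc a b → ℝ := fun w t =>
    ∑ i ∈ Finset.range n, (c i).indicator (fun _ => w i) t
  have hmeas : ∀ w, Measurable (stepFn w) := fun w =>
    Finset.measurable_sum _ fun i _ => measurable_const.indicator (hc i)
  -- every point but the left end lies in exactly one half-open cell
  have hex : ∀ t : Set.Icc a b, (t : ℝ) ≠ a →
      ∃ i < n, t ∈ c i ∧ ∀ w, stepFn w t = w i := by
    intro t ht
    have hat : p 0 < t := h0.le.trans_lt (lt_of_le_of_ne t.2.1 (Ne.symm ht))
    have hE : ∃ j, (t : ℝ) ≤ p j := ⟨n, t.2.2.trans hn.ge⟩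
    obtain ⟨j, hj⟩ : ∃ j, Nat.find hE = j + 1 :=
      Nat.exists_eq_succ_of_ne_zero fun hz => by
        have := Nat.find_spec hE; rw [hz] at this; linarith
    have h1 : (t : ℝ) ≤ p (j + 1) := hj ▸ Nat.find_spec hE
    have h2 : p j < t := not_le.1 (Nat.find_min hE (by omega))
    have hjn : j < n := by
      have := Nat.find_min' hE (t.2.2.trans hn.ge); omega
    refine ⟨j, hjn, ⟨h2, h1⟩, fun w => ?_⟩
    simp only [stepFn]
    rw [Finset.sum_eq_single_of_mem j (Finset.mem_range.2 hjn)]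
    · exact Set.indicator_of_mem (show t ∈ c j from ⟨h2, h1⟩) _
    · intro i _ hij
      refine Set.indicator_of_notMem (fun hti => ?_) _
      rcases lt_or_gt_of_ne hij with hlt | hgt
      · exact absurd (hti.2.trans (hp hlt)) (not_le.2 h2)
      · exact absurd (h1.trans (hp hgt)) (not_le.2 hti.1)
  have hvol : ∀ i < n, (Measure.comap Subtype.val volume : Measure (Set.Icc a b)) (c i)
      = ENNReal.ofReal (p (i + 1) - p i) := by
    intro i hi
    rw [comap_subtype_coe_apply measurableSet_Icc, Subtype.image_preimage_coe,
      Set.inter_eq_self_of_subset_right, Real.volume_Ioc]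
    rintro x ⟨hx1, hx2⟩
    exact ⟨h0.ge.trans ((hp (Nat.zero_le i)).trans hx1.le), (hx2.trans (hp hi)).trans hn.le⟩
  have hae : ∀ᵐ t : Set.Icc a b ∂(Measure.comap Subtype.val volume), (t : ℝ) ≠ a := by
    rw [ae_iff, comap_subtype_coe_apply measurableSet_Icc]
    refine measure_mono_null (t := ({a} : Set ℝ)) ?_ (by simp)
    rintro _ ⟨t, ht, rfl⟩
    simpa using ht
  refine ⟨stepFn m, stepFn M, hmeas m, hmeas M, ?_, ?_⟩
  · filter_upwards [hae] with t ht
    obtain ⟨i, hi, hti, hw⟩ := hex t ht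
    rw [hw, hw]
    exact hcell i hi t hti.1.le hti.2
  · have hmM : ∀ i < n, m i ≤ M i := by
      intro i hi
      have hmem : p i ∈ Set.Icc a b := ⟨h0.ge.trans (hp (Nat.zero_le i)), (hp hi.le).trans hn.le⟩
      have := hcell i hi ⟨p i, hmem⟩ le_rfl (hp (Nat.le_succ i))
      exact this.1.trans this.2
    calc ∫⁻ t, ENNReal.ofReal (stepFn M t - stepFn m t) ∂(volume.comap Subtype.val)
        ≤ ∫⁻ t, ∑ i ∈ Finset.range n,
            (c i).indicator (fun _ => ENNReal.ofReal (M i - m i)) t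
              ∂(volume.comap Subtype.val) := by
          refine lintegral_mono_ae ?_
          filter_upwards [hae] with t ht
          obtain ⟨i, hi, hti, hw⟩ := hex t ht
          rw [hw, hw]
          refine le_trans (le_of_eq ?_) (Finset.single_le_sum (f := fun i =>
            (c i).indicator (fun _ => ENNReal.ofReal (M i - m i)) t)
            (fun _ _ => bot_le) (Finset.mem_range.2 hi))
          simp only [Set.indicator_of_mem hti]
      _ = ∑ i ∈ Finset.range n, ENNReal.ofReal ((M i - m i) * (p (i + 1) - p i)) := by
          rw [lintegral_finsetSum _ fun i _ => measurable_const.indicator (hc i)]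
          refine Finset.sum_congr rfl fun i hi => ?_
          have hi := Finset.mem_range.1 hi
          rw [lintegral_indicator_const (hc i), hvol i hi,
            ENNReal.ofReal_mul (sub_nonneg.2 (hmM i hi))]
      _ = ENNReal.ofReal (∑ i ∈ Finset.range n, (M i - m i) * (p (i + 1) - p i)) := by
          rw [ENNReal.ofReal_sum_of_nonneg]
          intro i hi
          exact mul_nonneg (sub_nonneg.2 (hmM i (Finset.mem_range.1 hi)))
            (sub_nonneg.2 (hp (Nat.le_succ i)))
      _ ≤ ENNReal.ofReal ε := ENNReal.ofReal_le_ofReal hsum.le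

/-! ### Two duality lemmas -/

/-- Duality for the choice of at most `n` elements of largest total weight, for the sets `A` and
`insert k A` with the same multiplier: it can be taken to be the `n`-th largest weight in `A`, and
`0` if `A` has fewer than `n` elements. -/
theorem exists_threshold {ι : Type*} [DecidableEq ι] (d : ι → ℝ) (hd : ∀ i, 0 ≤ d i)
    (A : Finset ι) (k : ι) (hk : k ∉ A) (n : ℕ) (hn : 0 < n) :
    ∃ lam : ℝ, 0 ≤ lam ∧
      (∃ S ⊆ A, S.card ≤ n ∧ n * lam + ∑ i ∈ A, max 0 (d i - lam) ≤ ∑ i ∈ S, d i) ∧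
      (∃ S ⊆ insert k A, S.card ≤ n ∧
        n * lam + ∑ i ∈ insert k A, max 0 (d i - lam) ≤ ∑ i ∈ S, d i) := by
  rcases lt_or_ge A.card n with hA | hA
  · refine ⟨0, le_rfl, ⟨A, subset_rfl, hA.le, ?_⟩, ⟨insert k A, subset_rfl, ?_, ?_⟩⟩
    · simp [hd]
    · rw [Finset.card_insert_of_notMem hk]; omega
    · simp [hd]
  · obtain ⟨S, hS, hmax⟩ := Finset.exists_max_image (A.powersetCard n) (fun S => ∑ i ∈ S, d i)
      (Finset.powersetCard_nonempty.2 hA)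
    obtain ⟨hSA, hSn⟩ := Finset.mem_powersetCard.1 hS
    obtain ⟨j, hj, hmin⟩ := Finset.exists_min_image S d (Finset.card_pos.1 (by omega))
    have hout : ∀ i ∈ A \ S, d i ≤ d j := by
      intro i hi
      obtain ⟨hiA, hiS⟩ := Finset.mem_sdiff.1 hi
      have hi' : i ∉ S.erase j := fun h => hiS (Finset.mem_of_mem_erase h)
      have h1 := hmax (insert i (S.erase j)) (Finset.mem_powersetCard.2
        ⟨Finset.insert_subset hiA ((Finset.erase_subset _ _).trans hSA), by
          rw [Finset.card_insert_of_notMem hi', Finset.card_erase_of_mem hj]; omega⟩)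
      rw [Finset.sum_insert hi'] at h1
      linarith [Finset.add_sum_erase S d hj]
    have hsum : n * d j + ∑ i ∈ A, max 0 (d i - d j) = ∑ i ∈ S, d i := by
      rw [← Finset.sum_sdiff hSA, Finset.sum_eq_zero fun i hi =>
        max_eq_left (sub_nonpos.2 (hout i hi)), Finset.sum_congr rfl fun i hi =>
        max_eq_right (sub_nonneg.2 (hmin i hi)), Finset.sum_sub_distrib, Finset.sum_const, hSn,
        nsmul_eq_mul]
      ring
    refine ⟨d j, hd j, ⟨S, hSA, hSn.le, hsum.le⟩, ?_⟩
    rw [Finset.sum_insert hk]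
    rcases le_total (d k) (d j) with hkj | hkj
    · refine ⟨S, hSA.trans (Finset.subset_insert _ _), hSn.le, ?_⟩
      rw [max_eq_left (sub_nonpos.2 hkj)]
      linarith
    · have hk' : k ∉ S.erase j := fun h => hk (hSA (Finset.mem_of_mem_erase h))
      refine ⟨insert k (S.erase j), Finset.insert_subset_insert _
        ((Finset.erase_subset _ _).trans hSA), ?_, ?_⟩
      · rw [Finset.card_insert_of_notMem hk', Finset.card_erase_of_mem hj]; omega
      · rw [max_eq_right (sub_nonneg.2 hkj), Finset.sum_insert hk']
        linarith [Finset.add_sum_erase S d hj]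

/-- Strong duality for maximizing a concave function under one linear constraint `u p ≤ b`. The
linear bound `hgt` on the gain from exceeding the budget takes the place of a constraint
qualification and bounds the multiplier. -/
theorem exists_multiplier {E : Type*} [AddCommGroup E] [Module ℝ E] {P : Set E} {f : E → ℝ}
    (hf : ConcaveOn ℝ P f) (u : E →ₗ[ℝ] ℝ) {b C L : ℝ} (hL : 0 ≤ L)
    (hle : ∀ p ∈ P, u p ≤ b → f p ≤ C) (hgt : ∀ p ∈ P, b < u p → f p ≤ C + L * (u p - b)) :
    ∃ lam, 0 ≤ lam ∧ lam ≤ L ∧ ∀ p ∈ P, f p + lam * (b - u p) ≤ C := by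
  let R : Set ℝ := insert 0 ((fun p => (f p - C) / (u p - b)) '' {p ∈ P | b < u p})
  have hbdd : ∀ r ∈ R, r ≤ L := by
    rintro r (rfl | ⟨p, ⟨hp, hbp⟩, rfl⟩)
    · exact hL
    · rw [div_le_iff₀ (sub_pos.2 hbp)]
      linarith [hgt p hp hbp]
  have hB : BddAbove R := ⟨L, hbdd⟩
  have hne : R.Nonempty := ⟨0, Set.mem_insert _ _⟩
  refine ⟨sSup R, le_csSup hB (Set.mem_insert _ _), csSup_le hne hbdd, fun p hp => ?_⟩
  rcases lt_trichotomy (u p) b with h | h | h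
  · have hpos : 0 < b - u p := sub_pos.2 h
    suffices sSup R ≤ (C - f p) / (b - u p) by
      rw [le_div_iff₀ hpos] at this; linarith
    refine csSup_le hne ?_
    rintro r (rfl | ⟨q, ⟨hq, hbq⟩, rfl⟩)
    · exact div_nonneg (sub_nonneg.2 (hle p hp h.le)) hpos.le
    · have hqpos : 0 < u q - b := sub_pos.2 hbq
      have hs : 0 < u q - u p := by linarith
      -- the convex combination of `p` and `q` that spends exactly the budget `b`
      have hw : (u q - b) / (u q - u p) + (b - u p) / (u q - u p) = 1 := by
        field_simp; ring
      have hx := hf.1 hp hq (div_nonneg hqpos.le hs.le) (div_nonneg hpos.le hs.le) hw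
      have hc := hf.2 hp hq (div_nonneg hqpos.le hs.le) (div_nonneg hpos.le hs.le) hw
      have hu : u (((u q - b) / (u q - u p)) • p + ((b - u p) / (u q - u p)) • q) = b := by
        simp only [map_add, map_smul, smul_eq_mul]
        field_simp; ring
      have h1 := hc.trans (hle _ hx hu.le)
      simp only [smul_eq_mul] at h1
      rw [div_mul_eq_mul_div, div_mul_eq_mul_div, ← add_div, div_le_iff₀ hs] at h1
      rw [div_le_div_iff₀ hqpos hpos]
      nlinarith
  · rw [h]; simpa using hle p hp h.le
  · have h1 : (f p - C) / (u p - b) ≤ sSup R :=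
      le_csSup hB (Set.mem_insert_of_mem _ ⟨p, ⟨hp, h⟩, rfl⟩)
    rw [div_le_iff₀ (sub_pos.2 h)] at h1
    linarith

/-- Strong duality for maximizing a sum of concave functions of separate variables under one linear
budget constraint: the Lagrangian splits into one majorization per variable. -/
theorem exists_separable_multipliers {ι E : Type*} [Fintype ι] [AddCommGroup E] [Module ℝ E]
    [TopologicalSpace E] {Q : ι → Set E} (hQ : ∀ i, IsCompact (Q i)) (hne : ∀ i, (Q i).Nonempty)
    {f : ι → E → ℝ} (hf : ∀ i, ConcaveOn ℝ (Q i) (f i)) (hcont : ∀ i, Continuous (f i))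
    (u : E →ₗ[ℝ] ℝ) (hu : Continuous u) {b C L : ℝ} (hL : 0 ≤ L)
    (hle : ∀ p : ι → E, (∀ i, p i ∈ Q i) → ∑ i, u (p i) ≤ b → ∑ i, f i (p i) ≤ C)
    (hgt : ∀ p : ι → E, (∀ i, p i ∈ Q i) → b < ∑ i, u (p i) →
      ∑ i, f i (p i) ≤ C + L * (∑ i, u (p i) - b)) :
    ∃ (lam : ℝ) (Lam : ι → ℝ), 0 ≤ lam ∧ lam ≤ L ∧ b * lam + ∑ i, Lam i ≤ C ∧
      ∀ i, ∀ q ∈ Q i, f i q ≤ Lam i + lam * u q := by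
  have hconc : ConcaveOn ℝ (Set.univ.pi Q) (fun p : ι → E => ∑ i, f i (p i)) := by
    refine ⟨convex_pi fun i _ => (hf i).1, fun p hp q hq s t hs ht hst => ?_⟩
    simp only [smul_eq_mul, Finset.mul_sum, ← Finset.sum_add_distrib]
    exact Finset.sum_le_sum fun i _ =>
      (hf i).2 (hp i (Set.mem_univ i)) (hq i (Set.mem_univ i)) hs ht hst
  let U : (ι → E) →ₗ[ℝ] ℝ := ∑ i, u ∘ₗ LinearMap.proj i
  have hU : ∀ p, U p = ∑ i, u (p i) := fun p => by simp [U]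
  obtain ⟨lam, h0, h1, h2⟩ := exists_multiplier hconc U (b := b) (C := C) hL
    (fun p hp h => hle p (fun i => hp i (Set.mem_univ i)) (hU p ▸ h))
    (fun p hp h => hU p ▸ hgt p (fun i => hp i (Set.mem_univ i)) (hU p ▸ h))
  have hmax : ∀ i, ∃ q ∈ Q i, ∀ q' ∈ Q i, f i q' - lam * u q' ≤ f i q - lam * u q := fun i =>
    (hQ i).exists_isMaxOn (hne i)
      (f := fun q => f i q - lam * u q) (by have := hcont i; fun_prop)
  choose p hp hmax using hmax
  refine ⟨lam, fun i => f i (p i) - lam * u (p i), h0, h1, ?_, fun i q hq => ?_⟩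
  · have := h2 p fun i _ => hp i
    rw [hU] at this
    rw [Finset.sum_sub_distrib, ← Finset.mul_sum]
    linarith
  · linarith [hmax i q hq]

namespace StorageData

variable (D : StorageData)

/-! ### The rate of change of the state of charge -/

/-- The rate of change of the state of charge at power output `p`. -/
noncomputable def rate (p : ℝ) : ℝ := D.etaC * p⁻ - (1 / D.etaD) * p⁺

theorem etaC_lt_inv : D.etaC < D.etaD⁻¹ :=
  D.etaC_lt_one.trans ((one_lt_inv₀ D.etaD_pos).2 D.etaD_lt_one)

theorem deltaEta_pos : 0 < D.deltaEta := by
  have := D.etaC_lt_inv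
  simp only [deltaEta, one_div]
  linarith

theorem rate_of_nonneg {p : ℝ} (hp : 0 ≤ p) : D.rate p = -(p / D.etaD) := by
  rw [rate, posPart_of_nonneg hp, negPart_of_nonneg hp]; ring

theorem rate_of_nonpos {p : ℝ} (hp : p ≤ 0) : D.rate p = -D.etaC * p := by
  rw [rate, posPart_of_nonpos hp, negPart_of_nonpos hp]; ring

theorem rate_eq_min (p : ℝ) : D.rate p = min (-D.etaC * p) (-(p / D.etaD)) := by
  have h := D.etaC_lt_inv
  rcases le_total 0 p with hp | hp
  · rw [D.rate_of_nonneg hp, min_eq_right]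
    rw [div_eq_mul_inv]; nlinarith
  · rw [D.rate_of_nonpos hp, min_eq_left]
    rw [div_eq_mul_inv]; nlinarith

theorem rate_le_charge (p : ℝ) : D.rate p ≤ -D.etaC * p := D.rate_eq_min p ▸ min_le_left _ _

theorem rate_le_discharge (p : ℝ) : D.rate p ≤ -(p / D.etaD) :=
  D.rate_eq_min p ▸ min_le_right _ _

theorem rate_zero : D.rate 0 = 0 := by simp [D.rate_of_nonneg le_rfl]

theorem rate_mul {a : ℝ} (ha : 0 ≤ a) (p : ℝ) : D.rate (a * p) = a * D.rate p := by
  rw [rate_eq_min, rate_eq_min, mul_min_of_nonneg _ _ ha]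
  congr 1 <;> ring

theorem rate_add_le (p q : ℝ) : D.rate p + D.rate q ≤ D.rate (p + q) := by
  rw [D.rate_eq_min (p + q)]
  refine le_min ?_ ?_
  · linarith [D.rate_le_charge p, D.rate_le_charge q]
  · rw [add_div]; linarith [D.rate_le_discharge p, D.rate_le_discharge q]

theorem rate_antitone : Antitone D.rate := by
  intro p q h
  have h1 := D.rate_add_le (q - p) p
  have h2 : -D.etaC * p ≥ -D.etaC * q := by nlinarith [D.etaC_pos]
  have h3 : p / D.etaD ≤ q / D.etaD := div_le_div_of_nonneg_right h D.etaD_pos.le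
  rw [D.rate_eq_min q, D.rate_eq_min p]
  exact min_le_min h2 (neg_le_neg h3)

theorem rate_le_rate_add {p q : ℝ} (h : p ≤ q) : D.rate p ≤ D.rate q + (q - p) / D.etaD := by
  have h1 := D.rate_add_le p (q - p)
  rw [D.rate_of_nonneg (sub_nonneg.2 h), add_sub_cancel] at h1
  linarith

theorem continuous_rate : Continuous D.rate := by
  have : D.rate = fun p => min (-D.etaC * p) (-(p / D.etaD)) := funext D.rate_eq_min
  rw [this]
  fun_prop

theorem rate_convex_comb {s : ℝ} (h0 : 0 ≤ s) (h1 : s ≤ 1) (p q : ℝ) :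
    (1 - s) * D.rate p + s * D.rate q ≤ D.rate ((1 - s) * p + s * q) := by
  rw [← D.rate_mul h0, ← D.rate_mul (sub_nonneg.2 h1)]
  exact D.rate_add_le _ _

theorem power_of_nonneg {ξ : ℝ} (h : 0 ≤ ξ) (x0 xu xd : ℝ) :
    power x0 xu xd ξ = x0 + ξ * xu := by
  rw [power, posPart_of_nonneg h, negPart_of_nonneg h]; ring

theorem power_of_nonpos {ξ : ℝ} (h : ξ ≤ 0) (x0 xu xd : ℝ) :
    power x0 xu xd ξ = x0 + ξ * xd := by
  rw [power, posPart_of_nonpos h, negPart_of_nonpos h]; ring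

/-! ### Time within the trading intervals -/

/-- The time spent in the `l`-th trading interval up to time `t`. -/
noncomputable def elapsed (t : ℝ) (l : Fin D.K) : ℝ := max 0 (min D.dt (t - l * D.dt))

theorem elapsed_eq (k l : Fin D.K) {τ : ℝ} (h0 : 0 ≤ τ) (h1 : τ ≤ 1) :
    D.elapsed ((k + τ) * D.dt) l
      = if l < k then D.dt else if l = k then D.dt * τ else 0 := by
  have hdt := D.dt_pos
  rw [elapsed]
  split_ifs with h h'
  · have : ((l : ℕ) : ℝ) + 1 ≤ (k : ℕ) := by exact_mod_cast h
    rw [min_eq_left (by nlinarith), max_eq_right hdt.le]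
  · subst h'
    rw [min_eq_right (by nlinarith), max_eq_right (by nlinarith)]
    ring
  · have : ((k : ℕ) : ℝ) + 1 ≤ (l : ℕ) := by
      exact_mod_cast lt_of_le_of_ne (not_lt.1 h) (Ne.symm h')
    exact max_eq_left ((min_le_right _ _).trans (by nlinarith))

theorem sum_mul_elapsed (k : Fin D.K) {τ : ℝ} (h0 : 0 ≤ τ) (h1 : τ ≤ 1) (w : Fin D.K → ℝ) :
    ∑ l, w l * D.elapsed ((k + τ) * D.dt) l
      = D.dt * (∑ l ∈ Finset.Iio k, w l + τ * w k) := by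
  have h : ∀ l, w l * D.elapsed ((k + τ) * D.dt) l =
      (if l ∈ Finset.Iio k then w l * D.dt else 0) + (if l = k then w l * (D.dt * τ) else 0) := by
    intro l
    rw [D.elapsed_eq k l h0 h1]
    simp only [Finset.mem_Iio]
    split_ifs with h2 h3 h3
    · exact absurd h3 h2.ne
    all_goals ring
  rw [Finset.sum_congr rfl fun l _ => h l, Finset.sum_add_distrib, Finset.sum_ite_eq' _ k,
    Finset.sum_ite_mem]
  simp only [Finset.univ_inter, Finset.mem_univ, if_true, ← Finset.sum_mul]
  ring

/-- Sums over the index type of the constraints of interval `k`. -/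
theorem sum_Iic (k : Fin D.K) (w : Fin D.K → ℝ) :
    ∑ l : Set.Iic k, w l = ∑ l ∈ insert k (Finset.Iio k), w l := by
  have h : ∑ l ∈ Finset.Iic k, w l = ∑ l : Set.Iic k, w l :=
    Finset.sum_subtype (Finset.Iic k) (fun _ => Finset.mem_Iic) w
  rw [← h, ← Finset.Iio_insert]

variable {D} in
theorem le_of_mem_interval {k : Fin D.K} {t : D.Horizon} (ht : t ∈ D.interval k) :
    (t : ℝ) ≤ ((k : ℝ) + 1) * D.dt := by
  rcases ht.2 with h | h
  · exact h.le
  · have hK : (D.K : ℝ) = (k : ℝ) + 1 := by exact_mod_cast h.symm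
    exact t.2.2.trans (le_of_eq (congrArg (· * D.dt) hK))

theorem mem_interval_idx (t : D.Horizon) : t ∈ D.interval (D.idx t) := by
  have hdt := D.dt_pos
  have hK := D.K_pos
  change ((min ⌊(t : ℝ) / D.dt⌋₊ (D.K - 1) : ℕ) : ℝ) * D.dt ≤ t ∧
    ((t : ℝ) < (((min ⌊(t : ℝ) / D.dt⌋₊ (D.K - 1) : ℕ) : ℝ) + 1) * D.dt ∨
      min ⌊(t : ℝ) / D.dt⌋₊ (D.K - 1) + 1 = D.K)
  have hfl : ((⌊(t : ℝ) / D.dt⌋₊ : ℕ) : ℝ) ≤ t / D.dt :=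
    Nat.floor_le (div_nonneg t.2.1 hdt.le)
  rw [← le_div_iff₀ hdt, ← div_lt_iff₀ hdt]
  refine ⟨le_trans (by exact_mod_cast min_le_left _ _) hfl, ?_⟩
  rcases le_total ⌊(t : ℝ) / D.dt⌋₊ (D.K - 1) with h | h
  · rw [min_eq_left h]
    exact Or.inl (Nat.lt_floor_add_one _)
  · right
    rw [min_eq_right h]
    omega

theorem idx_eq_iff (t : D.Horizon) (k : Fin D.K) : D.idx t = k ↔ t ∈ D.interval k :=
  ⟨fun h => h ▸ D.mem_interval_idx t, D.idx_eq_of_mem⟩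

/-- The position of `t` within its trading interval; `τ = 1` occurs only at the end of the
horizon. -/
theorem exists_eq_add_mul (t : D.Horizon) :
    ∃ τ : ℝ, 0 ≤ τ ∧ τ ≤ 1 ∧ (t : ℝ) = (D.idx t + τ) * D.dt := by
  have hdt := D.dt_pos
  have ht := D.mem_interval_idx t
  refine ⟨t / D.dt - D.idx t, ?_, ?_, by field_simp; ring⟩
  · rw [sub_nonneg, le_div_iff₀ hdt]; exact ht.1
  · rw [sub_le_iff_le_add', div_le_iff₀ hdt]
    exact le_of_mem_interval ht

theorem add_mul_mem (k : Fin D.K) {τ : ℝ} (h0 : 0 ≤ τ) (h1 : τ ≤ 1) :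
    (k + τ) * D.dt ∈ Set.Icc (0 : ℝ) (D.K * D.dt) := by
  have hdt := D.dt_pos
  have hk : ((k : ℕ) : ℝ) + 1 ≤ D.K := by exact_mod_cast k.isLt
  exact ⟨by positivity, mul_le_mul_of_nonneg_right (by linarith) hdt.le⟩

theorem measurableSet_interval (k : Fin D.K) : MeasurableSet (D.interval k) := by
  have h1 : MeasurableSet {t : D.Horizon | (k : ℝ) * D.dt ≤ (t : ℝ)} :=
    measurableSet_le measurable_const measurable_subtype_coe
  have h2 : MeasurableSet {t : D.Horizon | (t : ℝ) < ((k : ℝ) + 1) * D.dt} :=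
    measurableSet_lt measurable_subtype_coe measurable_const
  exact h1.inter (h2.union (MeasurableSet.const _))

theorem measurable_idx : Measurable D.idx :=
  measurable_to_countable' fun k => by
    have : D.idx ⁻¹' {k} = D.interval k := Set.ext fun t => D.idx_eq_iff t k
    exact this ▸ D.measurableSet_interval k

instance : IsFiniteMeasure D.leb := ⟨by
  rw [leb, comap_subtype_coe_apply measurableSet_Icc, Set.image_univ, Subtype.range_coe]
  exact measure_Icc_lt_top⟩

theorem leb_real_interval_inter (t : D.Horizon) (l : Fin D.K) :
    D.leb.real (Set.Iic t ∩ D.interval l) = D.elapsed t l := by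
  have hdt := D.dt_pos
  have hl : ((l : ℕ) : ℝ) + 1 ≤ D.K := by exact_mod_cast l.isLt
  set c : ℝ := min (((l : ℝ) + 1) * D.dt) t with hc
  have hsub1 : Set.Ico ((l : ℝ) * D.dt) c ⊆ Subtype.val '' (Set.Iic t ∩ D.interval l) := by
    rintro s ⟨hs1, hs2⟩
    obtain ⟨h3, h4⟩ := lt_min_iff.1 hs2
    exact ⟨⟨s, (by positivity : (0 : ℝ) ≤ (l : ℝ) * D.dt).trans hs1, h4.le.trans t.2.2⟩,
      ⟨h4.le, hs1, Or.inl h3⟩, rfl⟩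
  have hsub2 : Subtype.val '' (Set.Iic t ∩ D.interval l) ⊆ Set.Icc ((l : ℝ) * D.dt) c := by
    rintro _ ⟨s, ⟨hs1, hs2⟩, rfl⟩
    exact ⟨hs2.1, le_min (le_of_mem_interval hs2) hs1⟩
  have hvol : D.leb (Set.Iic t ∩ D.interval l) = ENNReal.ofReal (c - l * D.dt) := by
    rw [leb, comap_subtype_coe_apply measurableSet_Icc]
    refine le_antisymm ((measure_mono hsub2).trans_eq Real.volume_Icc) ?_
    exact Real.volume_Ico.symm.le.trans (measure_mono hsub1)
  rw [Measure.real, hvol, ENNReal.toReal_ofReal', elapsed, max_comm, hc, ← min_sub_sub_right]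
  congr 2
  ring

theorem integrable_comp_idx (v : Fin D.K → ℝ) : Integrable (fun τ => v (D.idx τ)) D.leb := by
  refine Integrable.of_bound ((measurable_of_finite v).comp D.measurable_idx).aestronglyMeasurable
    (∑ l, |v l|) (Filter.Eventually.of_forall fun τ => ?_)
  exact Finset.single_le_sum (f := fun l => |v l|) (fun _ _ => abs_nonneg _) (Finset.mem_univ _)

theorem setIntegral_comp_idx (v : Fin D.K → ℝ) (t : D.Horizon) :
    ∫ τ in Set.Iic t, v (D.idx τ) ∂D.leb = ∑ l, v l * D.elapsed t l := by
  have h : ∀ τ, v (D.idx τ) = ∑ l, (D.interval l).indicator (fun _ => v l) τ := by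
    intro τ
    rw [Finset.sum_eq_single_of_mem (D.idx τ) (Finset.mem_univ _),
      Set.indicator_of_mem (D.mem_interval_idx τ)]
    intro l _ hl
    exact Set.indicator_of_notMem (fun hm => hl (D.idx_eq_of_mem hm).symm) _
  simp_rw [h]
  rw [integral_finsetSum _ fun l _ =>
    (integrable_const (v l)).indicator (D.measurableSet_interval l)]
  refine Finset.sum_congr rfl fun l _ => ?_
  rw [setIntegral_indicator (D.measurableSet_interval l), setIntegral_const,
    D.leb_real_interval_inter, smul_eq_mul, mul_comm]

theorem leb_real_interval (k : Fin D.K) : D.leb.real (D.interval k) = D.dt := by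
  have h1 := D.leb_real_interval_inter ⟨_, D.add_mul_mem k zero_le_one le_rfl⟩ k
  rw [D.elapsed_eq k k zero_le_one le_rfl, if_neg (lt_irrefl _), if_pos rfl, mul_one,
    Set.inter_eq_self_of_subset_right] at h1
  · exact h1
  · exact fun s hs => le_of_mem_interval hs

theorem avg_comp_idx (v : Fin D.K → ℝ) (k : Fin D.K) :
    D.avg (fun t => v (D.idx t)) k = v k := by
  have hdt := D.dt_pos
  rw [avg, setIntegral_congr_fun (g := fun _ => v k) (D.measurableSet_interval k)
    fun t ht => by simp only [D.idx_eq_of_mem ht], setIntegral_const, D.leb_real_interval,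
    smul_eq_mul]
  field_simp

/-! ### Signals and the state of charge -/

/-- The signal with value `v l` on the `l`-th trading interval, set to `0` after time `t`. -/
noncomputable def stepSignal (v : Fin D.K → ℝ) (t τ : D.Horizon) : ℝ :=
  if τ ≤ t then v (D.idx τ) else 0

variable {D}

theorem riemannIntegrable_stepSignal {v : Fin D.K → ℝ} (hv : ∀ l, |v l| ≤ 1) (t : D.Horizon) :
    RiemannIntegrable (D.stepSignal v t) := by
  classical
  have hdt := D.dt_pos
  have hT : (0 : ℝ) < D.K * D.dt := mul_pos (by exact_mod_cast D.K_pos) hdt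
  refine RiemannIntegrable.of_const_off_finset hT _
    (insert (t : ℝ) (Finset.univ.image fun i : Fin D.K => ((i : ℝ) + 1) * D.dt)) ?_ ?_
  · intro τ
    rw [stepSignal]
    split_ifs
    · exact abs_le.1 (hv _)
    · norm_num
  · intro s s' hss hno
    have ht := hno t (Finset.mem_insert_self _ _)
    have hidx : D.idx s' = D.idx s := by
      refine D.idx_eq_of_mem ?_
      obtain ⟨h1, h2⟩ := D.mem_interval_idx s
      refine ⟨h1.trans hss, h2.imp_left fun h => ?_⟩
      by_contra! hcon
      exact hno _ (Finset.mem_insert_of_mem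
        (Finset.mem_image_of_mem _ (Finset.mem_univ (D.idx s)))) ⟨h.le, hcon⟩
    have hiff : s ≤ t ↔ s' ≤ t :=
      ⟨fun h => (not_le.1 fun h' => ht ⟨h, h'⟩).le, hss.trans⟩
    simp only [stepSignal, hidx, hiff]

theorem stepSignal_mem_signals {v : Fin D.K → ℝ} (hv : ∀ l, |v l| ≤ 1) (t : D.Horizon)
    (hγ : ∑ l, |v l| * D.elapsed t l ≤ D.γ) : D.stepSignal v t ∈ D.signals := by
  refine ⟨riemannIntegrable_stepSignal hv t, fun τ => ?_, ?_⟩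
  · rw [stepSignal]
    split_ifs
    · exact abs_le.1 (hv _)
    · norm_num
  · have h : (fun τ => |D.stepSignal v t τ|) =
        (Set.Iic t).indicator (fun τ => |v (D.idx τ)|) := by
      ext τ
      simp only [stepSignal, Set.indicator, Set.mem_Iic]
      split_ifs <;> simp
    rw [h, integral_indicator measurableSet_Iic, D.setIntegral_comp_idx (fun l => |v l|)]
    exact hγ

theorem soc_stepSignal (b : D.BidVec) (v : Fin D.K → ℝ) (t : D.Horizon) :
    D.soc (D.lift b) (D.stepSignal v t) t
      = D.y0 + ∑ l, D.rate (power (b.x0 l) (b.xu l) (b.xd l) (v l)) * D.elapsed t l := by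
  rw [soc, ← D.setIntegral_comp_idx (fun l => D.rate (power (b.x0 l) (b.xu l) (b.xd l) (v l)))]
  congr 1
  refine setIntegral_congr_fun measurableSet_Iic fun τ hτ => ?_
  have : D.stepSignal v t τ = v (D.idx τ) := if_pos hτ
  simp only [output, this, rate]
  rfl

theorem output_le {ξ : ℝ} (h : ξ ∈ Set.Icc (-1 : ℝ) 1) (x0 : ℝ) (xu xd : ℝ≥0) :
    power x0 xu xd ξ ≤ x0 + xu ∧ x0 - xd ≤ power x0 xu xd ξ := by
  obtain ⟨h1, h2⟩ := h
  rcases le_total 0 ξ with h0 | h0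
  · rw [power_of_nonneg h0]
    constructor <;> nlinarith [xu.coe_nonneg, xd.coe_nonneg]
  · rw [power_of_nonpos h0]
    constructor <;> nlinarith [xu.coe_nonneg, xd.coe_nonneg]

theorem integrable_rate_output (b : D.BidVec) {ξ : D.Horizon → ℝ} (hξ : ξ ∈ D.signals) :
    Integrable (fun τ => D.rate (D.output (D.lift b) ξ τ)) D.leb := by
  obtain ⟨B, hB⟩ : ∃ B : ℝ, ∀ l, b.x0 l + b.xu l ≤ B ∧ -B ≤ b.x0 l - b.xd l := by
    refine ⟨∑ l, (|b.x0 l| + b.xu l + b.xd l), fun l => ?_⟩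
    have h := Finset.single_le_sum (f := fun l => |b.x0 l| + (b.xu l : ℝ) + b.xd l)
      (fun _ _ => by positivity) (Finset.mem_univ l)
    have h1 := abs_le.1 (le_refl |b.x0 l|)
    have h2 := (b.xu l).coe_nonneg
    have h3 := (b.xd l).coe_nonneg
    constructor <;> linarith
  have hm : AEMeasurable ξ D.leb := hξ.1.aemeasurable
  have hmv : ∀ v : Fin D.K → ℝ, Measurable fun τ => v (D.idx τ) := fun v =>
    (measurable_of_finite v).comp D.measurable_idx
  have hout : AEMeasurable (fun τ => D.output (D.lift b) ξ τ) D.leb := by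
    have h1 := hmv b.x0
    have h2 := hmv fun l => b.xu l
    have h3 := hmv fun l => b.xd l
    have h4 : AEMeasurable (fun τ => (ξ τ)⁺) D.leb := hm.max aemeasurable_const
    have h5 : AEMeasurable (fun τ => (ξ τ)⁻) D.leb := hm.neg.max aemeasurable_const
    exact (h1.aemeasurable.add (h4.mul h2.aemeasurable)).sub (h5.mul h3.aemeasurable)
  refine Integrable.of_mem_Icc (D.rate B) (D.rate (-B))
    (D.continuous_rate.measurable.comp_aemeasurable hout) (Filter.Eventually.of_forall fun τ => ?_)
  have := output_le (hξ.2.1 τ) (b.x0 (D.idx τ)) (b.xu (D.idx τ)) (b.xd (D.idx τ))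
  exact ⟨D.rate_antitone (this.1.trans (hB _).1), D.rate_antitone ((hB _).2.trans this.2)⟩

theorem integrable_abs_signal {ξ : D.Horizon → ℝ} (hξ : ξ ∈ D.signals) :
    Integrable (fun τ => |ξ τ|) D.leb :=
  (Integrable.of_mem_Icc (μ := D.leb) (-1) 1 hξ.1.aemeasurable
    (Filter.Eventually.of_forall fun τ => hξ.2.1 τ)).abs

/-- The Lagrangian bound: the deviation budget prices the term `lam * |ξ|`. -/
theorem setIntegral_majorant_le {ξ : D.Horizon → ℝ} (hξ : ξ ∈ D.signals) (t : D.Horizon)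
    {lam : ℝ} (hlam : 0 ≤ lam) (Lam : Fin D.K → ℝ) :
    ∫ τ in Set.Iic t, (Lam (D.idx τ) + lam * |ξ τ|) ∂D.leb
      ≤ ∑ l, Lam l * D.elapsed t l + lam * D.γ := by
  have hi := integrable_abs_signal hξ
  rw [integral_add (D.integrable_comp_idx Lam).integrableOn (hi.const_mul lam).integrableOn,
    D.setIntegral_comp_idx, integral_const_mul]
  gcongr
  exact (setIntegral_le_integral hi (Filter.Eventually.of_forall fun _ => abs_nonneg _)).trans
    hξ.2.2

theorem integrable_majorant {ξ : D.Horizon → ℝ} (hξ : ξ ∈ D.signals)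
    (lam : ℝ) (Lam : Fin D.K → ℝ) :
    Integrable (fun τ => Lam (D.idx τ) + lam * |ξ τ|) D.leb :=
  (D.integrable_comp_idx Lam).add ((integrable_abs_signal hξ).const_mul lam)

/-- An affine majorant of the rate under downregulation bounds the state of charge from above. -/
theorem soc_le {b : D.BidVec} {ξ : D.Horizon → ℝ} (hξ : ξ ∈ D.signals) (t : D.Horizon)
    {lam : ℝ} (hlam : 0 ≤ lam) {Lam : Fin D.K → ℝ}
    (h : ∀ l, ∀ s : ℝ, 0 ≤ s → s ≤ 1 → D.rate (b.x0 l - s * b.xd l) ≤ Lam l + lam * s) :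
    D.soc (D.lift b) ξ t ≤ D.y0 + (∑ l, Lam l * D.elapsed t l + lam * D.γ) := by
  refine add_le_add le_rfl (le_trans ?_ (setIntegral_majorant_le hξ t hlam Lam))
  refine setIntegral_mono (integrable_rate_output b hξ).integrableOn
    (integrable_majorant hξ lam Lam).integrableOn fun τ => ?_
  change D.rate (power (b.x0 (D.idx τ)) (b.xu (D.idx τ)) (b.xd (D.idx τ)) (ξ τ)) ≤ _
  obtain ⟨h1, h2⟩ := hξ.2.1 τ
  rcases le_total 0 (ξ τ) with h0 | h0
  · have h3 := h (D.idx τ) 0 le_rfl zero_le_one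
    rw [power_of_nonneg h0]
    refine (D.rate_antitone (?_ : b.x0 (D.idx τ) - 0 * b.xd (D.idx τ) ≤ _)).trans (h3.trans ?_)
    · have := mul_nonneg h0 (b.xu (D.idx τ)).coe_nonneg
      linarith
    · have := mul_nonneg hlam (abs_nonneg (ξ τ))
      linarith
  · rw [power_of_nonpos h0, abs_of_nonpos h0]
    refine le_trans (le_of_eq ?_) (h (D.idx τ) (-ξ τ) (by linarith) (by linarith))
    congr 1; ring

/-- An affine minorant of the rate under upregulation bounds the state of charge from below. -/
theorem le_soc {b : D.BidVec} {ξ : D.Horizon → ℝ} (hξ : ξ ∈ D.signals) (t : D.Horizon)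
    {lam : ℝ} (hlam : 0 ≤ lam) {Lam : Fin D.K → ℝ}
    (h : ∀ l, ∀ s : ℝ, 0 ≤ s → s ≤ 1 → -(Lam l + lam * s) ≤ D.rate (b.x0 l + s * b.xu l)) :
    D.y0 - (∑ l, Lam l * D.elapsed t l + lam * D.γ) ≤ D.soc (D.lift b) ξ t := by
  rw [sub_eq_add_neg]
  refine add_le_add le_rfl (le_trans (neg_le_neg (setIntegral_majorant_le hξ t hlam Lam)) ?_)
  rw [← integral_neg]
  refine setIntegral_mono (integrable_majorant hξ lam Lam).neg.integrableOn
    (integrable_rate_output b hξ).integrableOn fun τ => ?_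
  change _ ≤ D.rate (power (b.x0 (D.idx τ)) (b.xu (D.idx τ)) (b.xd (D.idx τ)) (ξ τ))
  obtain ⟨h1, h2⟩ := hξ.2.1 τ
  rcases le_total 0 (ξ τ) with h0 | h0
  · rw [power_of_nonneg h0, abs_of_nonneg h0]
    exact h (D.idx τ) (ξ τ) h0 h2
  · have h3 := h (D.idx τ) 0 le_rfl zero_le_one
    rw [power_of_nonpos h0]
    refine le_trans (le_trans ?_ h3)
      (D.rate_antitone (?_ : _ ≤ b.x0 (D.idx τ) + 0 * b.xu (D.idx τ)))
    · have := mul_nonneg hlam (abs_nonneg (ξ τ))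
      linarith
    · have := mul_nonneg (neg_nonneg.2 h0) (b.xd (D.idx τ)).coe_nonneg
      linarith

/-! ### From robust to finite feasibility -/

variable {c : D.Bids → EReal} {φ : D.Bids → ℝ → EReal} {b : D.BidVec}

theorem power_bounds_of_feasible (hR : D.lift b ∈ (D.robustProblem c φ).feasible) (k : Fin D.K) :
    b.x0 k + b.xu k ≤ D.xhi ∧ D.xlo ≤ b.x0 k - b.xd k := by
  have hdt := D.dt_pos
  let t : D.Horizon := ⟨((k : ℝ) + 0) * D.dt, D.add_mul_mem k le_rfl zero_le_one⟩
  have ht : D.idx t = k := D.idx_eq_of_mem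
    ⟨by change _ ≤ ((k : ℝ) + 0) * D.dt; rw [add_zero],
      Or.inl (by change ((k : ℝ) + 0) * D.dt < _; nlinarith)⟩
  -- a signal supported at the single instant `t` costs nothing
  have key : ∀ s : ℝ, |s| ≤ 1 → D.xlo ≤ power (b.x0 k) (b.xu k) (b.xd k) s ∧
      power (b.x0 k) (b.xu k) (b.xd k) s ≤ D.xhi := by
    intro s hs
    have hmem : D.stepSignal (fun l => if l = k then s else 0) t ∈ D.signals := by
      refine stepSignal_mem_signals (fun l => ?_) t ?_
      · split_ifs
        · exact hs
        · simp
      · rw [D.sum_mul_elapsed k le_rfl zero_le_one, Finset.sum_eq_zero]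
        · simpa using D.γ_nonneg
        · intro l hl
          rw [if_neg (Finset.mem_Iio.1 hl).ne, abs_zero]
    have h := hR t _ hmem
    have ho : D.output (D.lift b) (D.stepSignal (fun l => if l = k then s else 0) t) t
        = power (b.x0 k) (b.xu k) (b.xd k) s := by
      change power (b.x0 (D.idx t)) (b.xu (D.idx t)) (b.xd (D.idx t))
        (D.stepSignal (fun l => if l = k then s else 0) t t) = _
      rw [stepSignal, if_pos le_rfl, ht, if_pos rfl]
    rw [ho] at h
    exact ⟨h.1, h.2.1⟩
  have h1 := (key 1 (by simp)).2
  have h2 := (key (-1) (by simp)).1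
  rw [power_of_nonneg zero_le_one] at h1
  rw [power_of_nonpos (by norm_num)] at h2
  constructor <;> linarith

/-- The robust constraints at the instant `(k + τ) Δt`, tested with step signals. -/
theorem soc_bounds_of_feasible (hR : D.lift b ∈ (D.robustProblem c φ).feasible) (k : Fin D.K)
    {τ : ℝ} (h0 : 0 ≤ τ) (h1 : τ ≤ 1) (v : Fin D.K → ℝ) (hv : ∀ l, |v l| ≤ 1)
    (hγ : ∑ l, |v l| * D.elapsed ((k + τ) * D.dt) l ≤ D.γ) :
    D.ylo ≤ D.y0 + ∑ l, D.rate (power (b.x0 l) (b.xu l) (b.xd l) (v l))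
        * D.elapsed ((k + τ) * D.dt) l ∧
      D.y0 + ∑ l, D.rate (power (b.x0 l) (b.xu l) (b.xd l) (v l))
        * D.elapsed ((k + τ) * D.dt) l ≤ D.yhi := by
  have h := hR ⟨_, D.add_mul_mem k h0 h1⟩ _
    (stepSignal_mem_signals hv ⟨_, D.add_mul_mem k h0 h1⟩ hγ)
  rw [soc_stepSignal] at h
  exact h.2.2

variable (b) in
/-- The rate at which the storage is drained in interval `l` without regulation (negative when
charging). -/
noncomputable def drain (l : Fin D.K) : ℝ := -D.rate (b.x0 l)

variable (b) in
/-- The additional drain in interval `l` caused by full upregulation. -/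
noncomputable def extraDrain (l : Fin D.K) : ℝ := D.rate (b.x0 l) - D.rate (b.x0 l + b.xu l)

theorem extraDrain_nonneg (l : Fin D.K) : 0 ≤ extraDrain b l :=
  sub_nonneg.2 (D.rate_antitone (le_add_of_nonneg_right (b.xu l).coe_nonneg))

/-- Robust feasibility tested with full upregulation on the intervals in `S`. -/
theorem subset_bound_of_feasible (hR : D.lift b ∈ (D.robustProblem c φ).feasible) {n : ℕ}
    (hn : D.γ = n * D.dt) (k : Fin D.K) (S : Finset (Fin D.K))
    (hS : S ⊆ insert k (Finset.Iio k)) (hSn : S.card ≤ n) :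
    D.ylo ≤ D.y0 - D.dt * (∑ l ∈ insert k (Finset.Iio k), drain b l
      + ∑ l ∈ S, extraDrain b l) := by
  classical
  have hdt := D.dt_pos
  have hk : k ∉ Finset.Iio k := by simp
  have hsum : ∀ w : Fin D.K → ℝ, ∑ l, w l * D.elapsed ((k + 1) * D.dt) l
      = D.dt * ∑ l ∈ insert k (Finset.Iio k), w l := fun w => by
    rw [D.sum_mul_elapsed k zero_le_one le_rfl, Finset.sum_insert hk]; ring
  have h := (soc_bounds_of_feasible hR k zero_le_one le_rfl (fun l => if l ∈ S then 1 else 0)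
    (fun l => by split_ifs <;> simp) (by
      rw [hsum, hn, mul_comm]
      refine mul_le_mul_of_nonneg_right ?_ hdt.le
      have : ∀ l : Fin D.K, |if l ∈ S then (1 : ℝ) else 0| = if l ∈ S then 1 else 0 :=
        fun l => by split_ifs <;> simp
      rw [Finset.sum_congr rfl fun l _ => this l, Finset.sum_ite_mem,
        Finset.inter_eq_right.2 hS]
      simpa using hSn)).1
  rw [hsum] at h
  have hr : ∀ l, D.rate (power (b.x0 l) (b.xu l) (b.xd l) (if l ∈ S then 1 else 0))
      = -drain b l - if l ∈ S then extraDrain b l else 0 := by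
    intro l
    rw [drain, extraDrain]
    split_ifs
    · rw [power_of_nonneg zero_le_one, one_mul]; ring
    · rw [power_of_nonneg le_rfl, zero_mul, add_zero]; ring
  rw [Finset.sum_congr rfl fun l _ => hr l, Finset.sum_sub_distrib, Finset.sum_neg_distrib,
    Finset.sum_ite_mem, Finset.inter_eq_right.2 hS] at h
  linarith

theorem exists_lower_multiplier (hR : D.lift b ∈ (D.robustProblem c φ).feasible) {n : ℕ}
    (hn0 : 0 < n) (hn : D.γ = n * D.dt) (k : Fin D.K) :
    ∃ lam : ℝ, 0 ≤ lam ∧ D.ylo ≤ D.y0 - D.γ * lam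
      - D.dt * ∑ l : Set.Iic k, (drain b l + max 0 (extraDrain b l - lam)) := by
  have hk : k ∉ Finset.Iio k := by simp
  obtain ⟨lam, h0, -, S, hS, hSn, hle⟩ :=
    exists_threshold (extraDrain b) extraDrain_nonneg (Finset.Iio k) k hk n hn0
  refine ⟨lam, h0, (subset_bound_of_feasible hR hn k S hS hSn).trans ?_⟩
  rw [D.sum_Iic k fun l => drain b l + max 0 (extraDrain b l - lam),
    Finset.sum_add_distrib, hn]
  nlinarith [D.dt_pos, mul_le_mul_of_nonneg_left hle D.dt_pos.le]

theorem concaveOn_rate_comp (x0 xd : ℝ) {Q : Set (ℝ × ℝ)} (hQ : Convex ℝ Q) :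
    ConcaveOn ℝ Q (fun q => D.rate (q.1 * x0 - q.2 * xd)) := by
  refine ⟨hQ, fun p _ q _ s t hs ht _ => ?_⟩
  simp only [smul_eq_mul, Prod.fst_add, Prod.snd_add, Prod.smul_fst, Prod.smul_snd]
  rw [← D.rate_mul hs, ← D.rate_mul ht]
  refine (D.rate_add_le _ _).trans (le_of_eq ?_)
  congr 1; ring

/-- The pairs `(τ, σ)` of a running time `τ` between `lo` and `hi`, as a fraction of a trading
interval, and a total amount `σ ≤ τ` of downward deviation during it. -/
def runs (lo hi : ℝ) : Set (ℝ × ℝ) := {q | lo ≤ q.1 ∧ q.1 ≤ hi ∧ 0 ≤ q.2 ∧ q.2 ≤ q.1}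

theorem convex_runs (lo hi : ℝ) : Convex ℝ (runs lo hi) := by
  rintro p ⟨h1, h2, h3, h4⟩ q ⟨h5, h6, h7, h8⟩ s t hs ht hst
  have e1 : lo = s * lo + t * lo := by rw [← add_mul, hst, one_mul]
  have e2 : hi = s * hi + t * hi := by rw [← add_mul, hst, one_mul]
  simp only [runs, Set.mem_ofPred_eq, smul_eq_mul, Prod.fst_add, Prod.snd_add, Prod.smul_fst,
    Prod.smul_snd]
  refine ⟨?_, ?_, by positivity, by gcongr⟩
  · rw [e1]; gcongr
  · rw [e2]; gcongr

theorem isCompact_runs (lo hi : ℝ) : IsCompact (runs lo hi) := by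
  refine (isCompact_Icc (a := lo) (b := hi)).prod (isCompact_Icc (a := 0) (b := hi))
    |>.of_isClosed_subset ?_ ?_
  · exact (isClosed_le continuous_const continuous_fst).inter
      ((isClosed_le continuous_fst continuous_const).inter
      ((isClosed_le continuous_const continuous_snd).inter
        (isClosed_le continuous_snd continuous_fst)))
  · rintro q ⟨h1, h2, h3, h4⟩
    exact ⟨⟨h1, h2⟩, h3, h4.trans h2⟩

/-- Robust feasibility tested with downregulation `σ l` in the intervals `l < k` and `σ k` during
the fraction `τ k` of interval `k`; the running time is full before interval `k` and zero after. -/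
theorem runs_bound_of_feasible (hR : D.lift b ∈ (D.robustProblem c φ).feasible) (k : Fin D.K)
    (p : Fin D.K → ℝ × ℝ)
    (hp : ∀ l, p l ∈ runs (if l < k then 1 else 0) (if l ≤ k then 1 else 0))
    (hγ : D.dt * ∑ l, (p l).2 ≤ D.γ) :
    D.y0 + D.dt * ∑ l, D.rate ((p l).1 * b.x0 l - (p l).2 * b.xd l) ≤ D.yhi := by
  have hdt := D.dt_pos
  have hk0 : 0 ≤ (p k).1 := (hp k).2.2.1.trans (hp k).2.2.2
  have hk1 : (p k).1 ≤ 1 := by simpa using (hp k).2.1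
  have hel : ∀ l, D.elapsed ((k + (p k).1) * D.dt) l = D.dt * (p l).1 := by
    intro l
    obtain ⟨h1, h2, h3, h4⟩ := hp l
    rw [D.elapsed_eq k l hk0 hk1]
    split_ifs with h h'
    · rw [if_pos h] at h1
      rw [if_pos h.le] at h2
      rw [le_antisymm h2 h1, mul_one]
    · rw [h']
    · rw [if_neg fun h'' => (lt_or_eq_of_le h'').elim h h'] at h2
      rw [le_antisymm h2 (h3.trans h4), mul_zero]
  -- the deviation rate that spends `σ` within a running time `τ` is `σ / τ`
  have hdiv : ∀ l, (p l).2 / (p l).1 * (p l).1 = (p l).2 := by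
    intro l
    obtain ⟨-, -, h3, h4⟩ := hp l
    rcases eq_or_ne (p l).1 0 with h | h
    · rw [h, mul_zero]; linarith
    · exact div_mul_cancel₀ _ h
  have hnn : ∀ l, 0 ≤ (p l).2 / (p l).1 := fun l =>
    div_nonneg (hp l).2.2.1 ((hp l).2.2.1.trans (hp l).2.2.2)
  have habs : ∀ l, |-((p l).2 / (p l).1)| = (p l).2 / (p l).1 := fun l => by
    rw [abs_neg, abs_of_nonneg (hnn l)]
  have h := (soc_bounds_of_feasible hR k hk0 hk1 (fun l => -((p l).2 / (p l).1))
    (fun l => by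
      rw [habs]
      exact div_le_one_of_le₀ (hp l).2.2.2 ((hp l).2.2.1.trans (hp l).2.2.2)) (by
      refine le_trans (le_of_eq ?_) hγ
      rw [Finset.mul_sum]
      refine Finset.sum_congr rfl fun l _ => ?_
      rw [habs, hel]
      linear_combination D.dt * hdiv l)).2
  refine le_trans (le_of_eq ?_) h
  rw [Finset.mul_sum]
  congr 1
  refine Finset.sum_congr rfl fun l _ => ?_
  have hτ : 0 ≤ (p l).1 := (hp l).2.2.1.trans (hp l).2.2.2
  have he : (p l).1 * b.x0 l - (p l).2 * b.xd l
      = (p l).1 * (b.x0 l + -((p l).2 / (p l).1) * b.xd l) := by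
    linear_combination (b.xd l : ℝ) * hdiv l
  rw [power_of_nonpos (neg_nonpos.2 (hnn l)), hel, he, D.rate_mul hτ]
  ring

/-- The dual variables of the upper-SOC constraints. The point `(0, 0)` of `runs 0 1` is responsible
for `0 ≤ Lam k`: the state of charge may peak at the start of interval `k`. -/
theorem exists_upper_multipliers (hR : D.lift b ∈ (D.robustProblem c φ).feasible) (k : Fin D.K) :
    ∃ (lam : ℝ) (Lam : Fin D.K → ℝ), 0 ≤ lam ∧ lam ≤ (D.xhi - D.xlo) / D.etaD ∧
      D.y0 + D.γ * lam + D.dt * ∑ l : Set.Iic k, Lam l ≤ D.yhi ∧ 0 ≤ Lam k ∧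
      ∀ l ≤ k, ∀ s : ℝ, 0 ≤ s → s ≤ 1 → D.rate (b.x0 l - s * b.xd l) ≤ Lam l + lam * s := by
  have hdt := D.dt_pos
  have hη := D.etaD_pos
  have hdx : ∀ l, (b.xd l : ℝ) ≤ D.xhi - D.xlo := fun l => by
    have h := power_bounds_of_feasible hR l
    have := (b.xu l).coe_nonneg
    linarith
  have hL : 0 ≤ (D.xhi - D.xlo) / D.etaD :=
    div_nonneg (by linarith [D.xlo_nonpos, D.xhi_nonneg]) hη.le
  have hle : ∀ p : Fin D.K → ℝ × ℝ,
      (∀ l, p l ∈ runs (if l < k then 1 else 0) (if l ≤ k then 1 else 0)) →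
      ∑ l, (p l).2 ≤ D.γ / D.dt →
      ∑ l, D.rate ((p l).1 * b.x0 l - (p l).2 * b.xd l) ≤ (D.yhi - D.y0) / D.dt := by
    intro p hp hu
    rw [le_div_iff₀ hdt] at hu ⊢
    have := runs_bound_of_feasible hR k p hp (by linarith)
    linarith
  obtain ⟨lam, Lam, h0, h1, h2, h3⟩ := exists_separable_multipliers
    (Q := fun l : Fin D.K => runs (if l < k then 1 else 0) (if l ≤ k then 1 else 0))
    (f := fun l q => D.rate (q.1 * b.x0 l - q.2 * b.xd l))
    (fun l => isCompact_runs _ _)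
    (fun l => ⟨(if l < k then 1 else 0, 0), le_rfl, by
      dsimp only
      split_ifs with h h'
      · exact le_rfl
      · exact absurd h.le h'
      · exact zero_le_one
      · exact le_rfl, le_rfl, by dsimp only; split_ifs <;> norm_num⟩)
    (fun l => concaveOn_rate_comp _ _ (convex_runs _ _))
    (fun l => D.continuous_rate.comp (by fun_prop))
    (LinearMap.snd ℝ ℝ ℝ) continuous_snd hL hle (fun p hp hu => by
      -- scale the deviations down to the budget
      simp only [LinearMap.snd_apply] at hu ⊢
      have hγ : 0 ≤ D.γ / D.dt := div_nonneg D.γ_nonneg hdt.le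
      have hpos : 0 < ∑ l, (p l).2 := hγ.trans_lt hu
      obtain ⟨θ, hθ⟩ : ∃ θ, θ = D.γ / D.dt / ∑ l, (p l).2 := ⟨_, rfl⟩
      have hθ0 : 0 ≤ θ := hθ ▸ div_nonneg hγ hpos.le
      have hθ1 : θ ≤ 1 := hθ ▸ (div_le_one hpos).2 hu.le
      have hθu : θ * ∑ l, (p l).2 = D.γ / D.dt := by rw [hθ]; field_simp
      have h := hle (fun l => ((p l).1, θ * (p l).2))
        (fun l => ⟨(hp l).1, (hp l).2.1, mul_nonneg hθ0 (hp l).2.2.1,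
          (mul_le_of_le_one_left (hp l).2.2.1 hθ1).trans (hp l).2.2.2⟩)
        (by rw [← Finset.mul_sum, hθu])
      have hl : ∀ l, D.rate ((p l).1 * b.x0 l - (p l).2 * b.xd l)
          ≤ D.rate ((p l).1 * b.x0 l - θ * (p l).2 * b.xd l)
            + (D.xhi - D.xlo) / D.etaD * ((1 - θ) * (p l).2) := by
        intro l
        have hnn : 0 ≤ (1 - θ) * (p l).2 := mul_nonneg (sub_nonneg.2 hθ1) (hp l).2.2.1
        have h5 := mul_nonneg hnn (b.xd l).coe_nonneg
        have h6 := mul_le_mul_of_nonneg_left (hdx l) hnn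
        refine (D.rate_le_rate_add (q := (p l).1 * b.x0 l - θ * (p l).2 * b.xd l)
          (by linarith)).trans (add_le_add le_rfl ?_)
        rw [div_mul_eq_mul_div]
        exact div_le_div_of_nonneg_right (by linarith) hη.le
      refine (Finset.sum_le_sum fun l _ => hl l).trans ?_
      rw [Finset.sum_add_distrib, ← Finset.mul_sum, ← Finset.mul_sum]
      have : (1 - θ) * ∑ l, (p l).2 = ∑ l, (p l).2 - D.γ / D.dt := by rw [← hθu]; ring
      rw [this]
      linarith)
  have hLk : ∀ l, k ≤ l → 0 ≤ Lam l := by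
    intro l hl
    have := h3 l (0, 0) ⟨by simp [not_lt.2 hl], by dsimp only; split_ifs <;> norm_num,
      le_rfl, le_rfl⟩
    simpa [rate_zero] using this
  refine ⟨lam, Lam, h0, h1, ?_, hLk k le_rfl, fun l hl s hs0 hs1 => ?_⟩
  · have hsub : ∑ l : Set.Iic k, Lam l ≤ ∑ l, Lam l := by
      rw [D.sum_Iic k Lam]
      refine Finset.sum_le_sum_of_subset_of_nonneg (Finset.subset_univ _) fun l _ hl => hLk l ?_
      by_contra! hcon
      exact hl (Finset.mem_insert_of_mem (Finset.mem_Iio.2 hcon))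
    rw [le_div_iff₀ hdt, add_mul, mul_right_comm, div_mul_cancel₀ _ hdt.ne'] at h2
    nlinarith [mul_le_mul_of_nonneg_left hsub hdt.le]
  · have := h3 l (1, s) ⟨by dsimp only; split_ifs <;> norm_num, by simp [hl], hs0, hs1⟩
    simpa using this

/-- The bilinear constraint, with `υ₁` and `υ₂` encoding `0 ≤ x0 - xd` and `x0 ≤ 0`. Its right-hand
side vanishes in the case `0 < x0 < xd` and is otherwise so small that the constraint is implied. -/
theorem bilinear_of_majorant {x0 xd lam Lam : ℝ} (h0 : 0 ≤ lam)
    (h1 : lam ≤ (D.xhi - D.xlo) / D.etaD) (hd : 0 ≤ xd) (hlo : D.xlo ≤ x0 - xd)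
    (hhi : x0 ≤ D.xhi)
    (h : ∀ s : ℝ, 0 ≤ s → s ≤ 1 → D.rate (x0 - s * xd) ≤ Lam + lam * s) :
    (if x0 ≤ 0 then 1 else 0) * (D.xlo * (D.xhi - D.xlo) / D.etaD)
      - (if 0 ≤ x0 - xd then 1 else 0) * (D.xhi ^ 2 / (4 * D.etaD)) ≤ Lam * xd + lam * x0 := by
  have hη := D.etaD_pos
  have hxlo := D.xlo_nonpos
  have hs0 := h 0 le_rfl zero_le_one
  have hs1 := h 1 zero_le_one le_rfl
  rw [zero_mul, sub_zero, mul_zero, add_zero] at hs0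
  rw [one_mul, mul_one] at hs1
  have hsq : 0 ≤ D.xhi ^ 2 / (4 * D.etaD) := by positivity
  rcases le_or_gt x0 0 with hx | hx
  · rw [if_pos hx, one_mul]
    rw [D.rate_of_nonpos hx] at hs0
    have hLam : 0 ≤ Lam := by nlinarith [D.etaC_pos]
    -- here the bound on `lam` is needed
    have h2 : D.xlo * (D.xhi - D.xlo) / D.etaD ≤ lam * x0 := by
      rw [mul_div_assoc]
      nlinarith
    have h3 : 0 ≤ Lam * xd := mul_nonneg hLam hd
    split_ifs <;> linarith
  · rw [if_neg (not_le.2 hx), zero_mul]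
    split_ifs with hy
    · rw [D.rate_of_nonneg hx.le] at hs0
      rw [D.rate_of_nonneg hy] at hs1
      have h2 : D.xhi ^ 2 / (4 * D.etaD) ≥ (x0 - xd) / D.etaD * xd := by
        rw [div_mul_eq_mul_div, ge_iff_le, div_le_div_iff₀ hη (by positivity)]
        have : 4 * ((x0 - xd) * xd) ≤ D.xhi ^ 2 := by nlinarith [sq_nonneg (x0 - 2 * xd)]
        nlinarith
      nlinarith [mul_le_mul_of_nonneg_right hs1 hd, mul_nonneg h0 hy]
    · -- the output vanishes at the interior deviation rate `x0 / xd`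
      have hxd : 0 < xd := by linarith
      have h2 := h (x0 / xd) (by positivity) ((div_le_one hxd).2 (by linarith))
      rw [div_mul_cancel₀ _ hxd.ne', sub_self, rate_zero, mul_div_assoc'] at h2
      have h3 := mul_le_mul_of_nonneg_right h2 hxd.le
      rw [add_mul, div_mul_cancel₀ _ hxd.ne'] at h3
      linarith

/-- A majorant at the ends and at the kink `s = x0 / xd` of the concave piecewise linear function
`s ↦ rate (x0 - s * xd)` is a majorant on `[0, 1]`. -/
theorem majorant_of_constraints {x0 xd lam Lam : ℝ} (hd : 0 ≤ xd)
    (hs0 : D.rate x0 ≤ Lam) (hs1 : D.rate (x0 - xd) ≤ Lam + lam)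
    (hmid : 0 < x0 → x0 < xd → 0 ≤ Lam * xd + lam * x0) {s : ℝ} (h0 : 0 ≤ s) (h1 : s ≤ 1) :
    D.rate (x0 - s * xd) ≤ Lam + lam * s := by
  have hη := D.etaD_pos
  have hs : 0 ≤ 1 - s := sub_nonneg.2 h1
  rcases le_or_gt x0 0 with hx | hx
  · rw [D.rate_of_nonpos hx] at hs0
    rw [D.rate_of_nonpos (by linarith)] at hs1
    refine (D.rate_le_charge _).trans ?_
    nlinarith [mul_le_mul_of_nonneg_left hs0 hs, mul_le_mul_of_nonneg_left hs1 h0]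
  rcases le_or_gt xd x0 with hy | hy
  · rw [D.rate_of_nonneg hx.le] at hs0
    rw [D.rate_of_nonneg (sub_nonneg.2 hy)] at hs1
    refine (D.rate_le_discharge _).trans ?_
    rw [sub_div] at hs1 ⊢
    rw [mul_div_assoc]
    nlinarith [mul_le_mul_of_nonneg_left hs0 hs, mul_le_mul_of_nonneg_left hs1 h0]
  · have hxd : 0 < xd := hx.trans hy
    have hm := hmid hx hy
    rw [D.rate_of_nonneg hx.le] at hs0
    rw [D.rate_of_nonpos (by linarith)] at hs1
    refine le_of_mul_le_mul_right (a := xd) ?_ hxd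
    rcases le_total (s * xd) x0 with hz | hz
    · -- interpolate between the deviation rates `0` and `x0 / xd`
      rw [D.rate_of_nonneg (sub_nonneg.2 hz)]
      refine le_of_mul_le_mul_right (a := x0) ?_ hx
      have h2 := mul_le_mul_of_nonneg_left hs0 (mul_nonneg hxd.le (sub_nonneg.2 hz))
      have h3 := mul_nonneg (mul_nonneg h0 hxd.le) hm
      have e : -((x0 - s * xd) / D.etaD) * xd * x0 = xd * (x0 - s * xd) * -(x0 / D.etaD) := by
        ring
      rw [e]
      linarith
    · -- interpolate between the deviation rates `x0 / xd` and `1`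
      rw [D.rate_of_nonpos (sub_nonpos.2 hz)]
      refine le_of_mul_le_mul_right (a := xd - x0) ?_ (sub_pos.2 hy)
      have h2 := mul_le_mul_of_nonneg_left hs1 (mul_nonneg hxd.le (sub_nonneg.2 hz))
      have h3 := mul_nonneg (mul_nonneg hs hxd.le) hm
      nlinarith

/-- Robustly feasible bids can be completed to a feasible point of the finite problem. -/
theorem exists_finite_feasible (hγ : ∃ n : ℕ, 0 < n ∧ D.γ = n * D.dt)
    (hR : D.lift b ∈ (D.robustProblem c φ).feasible) :
    ∃ z ∈ (D.finiteProblem c φ).feasible, z.bids = b ∧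
      ∀ k, z.lamHi k ≤ (D.xhi - D.xlo) / D.etaD := by
  obtain ⟨n, hn0, hn⟩ := hγ
  have hpow := power_bounds_of_feasible hR
  have hxu : ∀ l, 0 ≤ (b.xu l : ℝ) := fun l => (b.xu l).coe_nonneg
  have hxd : ∀ l, 0 ≤ (b.xd l : ℝ) := fun l => (b.xd l).coe_nonneg
  have hx0lo : ∀ l, D.xlo ≤ b.x0 l := fun l => by linarith [hpow l, hxd l]
  have hx0hi : ∀ l, b.x0 l ≤ D.xhi := fun l => by linarith [hpow l, hxu l]
  have hxlo := D.xlo_nonpos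
  have hxhi := D.xhi_nonneg
  have hΔ := D.deltaEta_pos
  have hη : ∀ p : ℝ, p / D.etaD = D.etaC * p + D.deltaEta * p := fun p => by
    rw [deltaEta]; ring
  choose lamLo hlo0 hlo using exists_lower_multiplier hR hn0 hn
  choose lamHi LamHi hhi0 hhiL hsoc hdiag hmaj using exists_upper_multipliers hR
  have hmaj0 : ∀ k, ∀ l ≤ k, D.rate (b.x0 l) ≤ LamHi k l := fun k l hl => by
    simpa using hmaj k l hl 0 le_rfl zero_le_one
  have hmaj1 : ∀ k, ∀ l ≤ k, D.rate (b.x0 l - b.xd l) - lamHi k ≤ LamHi k l := fun k l hl => by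
    simpa using hmaj k l hl 1 zero_le_one le_rfl
  let z : D.ProgVar :=
    { bids := b
      α := drain b
      β := fun l => drain b l + extraDrain b l
      lamLo := lamLo
      lamHi := lamHi
      LamLo := fun k l => max 0 (extraDrain b l - lamLo k)
      LamHi := fun k l => LamHi k l
      υ₁ := fun k => if 0 ≤ b.x0 k - b.xd k then 1 else 0
      υ₂ := fun k => if b.x0 k ≤ 0 then 1 else 0 }
  refine ⟨z, ⟨?_, ?_, ?_, ?_⟩, rfl, hhiL⟩
  · refine ⟨hlo0, hhi0, fun k l => le_max_left _ _, fun k => ?_, fun k => ?_⟩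
    · by_cases h : 0 ≤ b.x0 k - b.xd k <;> simp [z, h]
    · by_cases h : b.x0 k ≤ 0 <;> simp [z, h]
  · exact ⟨fun k => (hpow k).1, fun k => (hpow k).2⟩
  · have hα : ∀ k, D.etaC * b.x0 k ≤ drain b k ∧ b.x0 k / D.etaD ≤ drain b k := fun k => by
      have h1 := D.rate_le_charge (b.x0 k)
      have h2 := D.rate_le_discharge (b.x0 k)
      rw [drain]
      constructor <;> linarith
    have hβ : ∀ k, D.etaC * (b.x0 k + b.xu k) ≤ drain b k + extraDrain b k ∧
        (b.x0 k + b.xu k) / D.etaD ≤ drain b k + extraDrain b k := fun k => by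
      have h1 := D.rate_le_charge (b.x0 k + b.xu k)
      have h2 := D.rate_le_discharge (b.x0 k + b.xu k)
      rw [drain, extraDrain]
      constructor <;> linarith
    refine ⟨hlo, fun k => (hα k).1, fun k => (hα k).2, fun k => (hβ k).1, fun k => (hβ k).2,
      fun k l => ?_⟩
    have := le_max_right 0 (extraDrain b l - lamLo k)
    simp only [z]
    linarith
  · refine ⟨hsoc, fun k => ?_, fun k => ?_, hdiag, fun k => ?_, fun k => ?_, fun k => ?_,
      fun k => ?_, fun k l h => ?_, fun k l h => ?_, fun k l h => ?_, fun k l h => ?_,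
      fun k l h => ?_⟩
    · change -D.etaC * b.x0 k ≤ LamHi k k
      rcases le_total (b.x0 k) 0 with hx | hx
      · exact D.rate_of_nonpos hx ▸ hmaj0 k k le_rfl
      · nlinarith [hdiag k, D.etaC_pos]
    · change D.etaC * (b.xd k - b.x0 k) - lamHi k ≤ LamHi k k
      rcases le_total (b.x0 k - b.xd k) 0 with hx | hx
      · have := hmaj1 k k le_rfl
        rw [D.rate_of_nonpos hx] at this
        linarith
      · nlinarith [hdiag k, D.etaC_pos, hhi0 k]
    · change (1 - if 0 ≤ b.x0 k - b.xd k then 1 else 0) * D.xlo ≤ b.x0 k - b.xd k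
      have := hpow k
      split_ifs with hx <;> linarith
    · change b.x0 k - b.xd k ≤ (if 0 ≤ b.x0 k - b.xd k then 1 else 0) * D.xhi
      have := hx0hi k
      have := hxd k
      split_ifs with hx <;> linarith
    · change (if b.x0 k ≤ 0 then 1 else 0) * D.xlo ≤ b.x0 k
      have := hx0lo k
      split_ifs with hx <;> linarith
    · change b.x0 k ≤ (1 - if b.x0 k ≤ 0 then 1 else 0) * D.xhi
      have := hx0hi k
      split_ifs with hx <;> linarith
    · change (b.xd l - b.x0 l) / D.etaD - lamHi k
        + (1 - if 0 ≤ b.x0 l - b.xd l then 1 else 0) * D.deltaEta * D.xlo ≤ LamHi k l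
      refine le_trans ?_ (hmaj1 k l h.le)
      have := (hpow l).2
      split_ifs with hx
      · rw [D.rate_of_nonneg hx, hη, hη]; linarith
      · rw [D.rate_of_nonpos (not_le.1 hx).le, hη]; nlinarith
    · change -(b.x0 l / D.etaD) + (if b.x0 l ≤ 0 then 1 else 0) * D.deltaEta * D.xlo
        ≤ LamHi k l
      refine le_trans ?_ (hmaj0 k l h.le)
      have := hx0lo l
      split_ifs with hx
      · rw [D.rate_of_nonpos hx, hη]; nlinarith
      · rw [D.rate_of_nonneg (not_le.1 hx).le]; linarith
    · change D.etaC * (b.xd l - b.x0 l) - lamHi k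
        - (if 0 ≤ b.x0 l - b.xd l then 1 else 0) * D.deltaEta * D.xhi ≤ LamHi k l
      refine le_trans ?_ (hmaj1 k l h.le)
      have := hx0hi l
      have := hxd l
      split_ifs with hx
      · rw [D.rate_of_nonneg hx, hη]; nlinarith
      · rw [D.rate_of_nonpos (not_le.1 hx).le]; linarith
    · change -D.etaC * b.x0 l - (1 - if b.x0 l ≤ 0 then 1 else 0) * D.deltaEta * D.xhi
        ≤ LamHi k l
      refine le_trans ?_ (hmaj0 k l h.le)
      have := hx0hi l
      split_ifs with hx
      · rw [D.rate_of_nonpos hx]; linarith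
      · rw [D.rate_of_nonneg (not_le.1 hx).le, hη]; nlinarith
    · exact bilinear_of_majorant (hhi0 k) (hhiL k) (hxd l) (hpow l).2 (hx0hi l) (hmaj k l h.le)

/-! ### From finite to robust feasibility -/

/-- Weak duality: the lower-SOC constraints of interval `k` cover full upregulation on any set of at
most `n` intervals. -/
theorem subset_bound_of_lowerSOC {z : D.ProgVar} (hz : D.Domains z) (hl : D.LowerSOC z) {n : ℕ}
    (hn : D.γ = n * D.dt) (k : Fin D.K) (S : Finset (Fin D.K))
    (hS : S ⊆ insert k (Finset.Iio k)) (hSn : S.card ≤ n) :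
    D.ylo ≤ D.y0 - D.dt * (∑ l ∈ insert k (Finset.Iio k), drain z.bids l
      + ∑ l ∈ S, extraDrain z.bids l) := by
  classical
  have hdt := D.dt_pos
  have hα : ∀ l, drain z.bids l ≤ z.α l := fun l => by
    rw [drain, rate_eq_min, neg_le, le_min_iff]
    have h1 := hl.α_charge l
    have h2 := hl.α_discharge l
    constructor <;> linarith
  have hβ : ∀ l, drain z.bids l + extraDrain z.bids l ≤ z.β l := fun l => by
    have e : drain z.bids l + extraDrain z.bids l = -D.rate (z.bids.x0 l + z.bids.xu l) := by
      rw [drain, extraDrain]; ring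
    rw [e, neg_le, rate_eq_min, le_min_iff]
    have h1 := hl.β_charge l
    have h2 := hl.β_discharge l
    constructor <;> linarith
  have hterm : ∀ l : Set.Iic k,
      drain z.bids l + (if (l : Fin D.K) ∈ S then extraDrain z.bids l else 0)
      ≤ (z.α l + z.LamLo k l) + (if (l : Fin D.K) ∈ S then z.lamLo k else 0) := by
    intro l
    have h1 := hα l
    have h2 := hβ l
    have h3 := hl.dual k l
    have h4 := hz.LamLo_nonneg k l
    split_ifs <;> linarith
  have hsum := Finset.sum_le_sum fun l (_ : l ∈ Finset.univ) => hterm l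
  rw [D.sum_Iic k fun l => drain z.bids l + (if l ∈ S then extraDrain z.bids l else 0),
    Finset.sum_add_distrib, Finset.sum_add_distrib,
    D.sum_Iic k fun l => if l ∈ S then z.lamLo k else 0, Finset.sum_ite_mem, Finset.sum_ite_mem,
    Finset.inter_eq_right.2 hS, Finset.sum_const, nsmul_eq_mul] at hsum
  have hcard : (S.card : ℝ) * z.lamLo k ≤ n * z.lamLo k :=
    mul_le_mul_of_nonneg_right (by exact_mod_cast hSn) (hz.lamLo_nonneg k)
  have hsoc := hl.soc k
  rw [hn] at hsoc
  nlinarith [mul_le_mul_of_nonneg_left (hsum.trans (add_le_add le_rfl hcard)) hdt.le]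

theorem le_soc_of_finite {z : D.ProgVar} (hz : D.Domains z) (hl : D.LowerSOC z)
    (hγ : ∃ n : ℕ, 0 < n ∧ D.γ = n * D.dt) (hy0 : D.ylo ≤ D.y0) {ξ : D.Horizon → ℝ}
    (hξ : ξ ∈ D.signals) (t : D.Horizon) : D.ylo ≤ D.soc (D.lift z.bids) ξ t := by
  classical
  obtain ⟨n, hn0, hn⟩ := hγ
  have hdt := D.dt_pos
  obtain ⟨τ, h0, h1, hτ⟩ := D.exists_eq_add_mul t
  obtain ⟨k, hk⟩ : ∃ k, k = D.idx t := ⟨_, rfl⟩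
  rw [← hk] at hτ
  have hkm : k ∉ Finset.Iio k := by simp
  obtain ⟨lam, hlam, ⟨S, hS, hSn, hle⟩, S', hS', hSn', hle'⟩ :=
    exists_threshold (extraDrain z.bids) extraDrain_nonneg (Finset.Iio k) k hkm n hn0
  -- the start of the interval: the end of the previous interval, or time zero
  have hstart : D.ylo ≤ D.y0 - D.dt * (∑ l ∈ Finset.Iio k, drain z.bids l
      + ∑ l ∈ S, extraDrain z.bids l) := by
    by_cases hk0 : (k : ℕ) = 0
    · have hempty : Finset.Iio k = ∅ := by
        ext l
        simp only [Finset.mem_Iio, Finset.notMem_empty, iff_false, Fin.lt_def]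
        omega
      rw [hempty] at hS ⊢
      rw [Finset.subset_empty.1 hS]
      simpa using hy0
    · let j : Fin D.K := ⟨k - 1, by have := k.isLt; omega⟩
      have hj : Finset.Iio k = insert j (Finset.Iio j) := by
        ext l
        simp only [Finset.mem_Iio, Finset.mem_insert, Fin.lt_def, Fin.ext_iff, j]
        omega
      rw [hj] at hS ⊢
      exact subset_bound_of_lowerSOC hz hl hn j S hS hSn
  have hend := subset_bound_of_lowerSOC hz hl hn k S' hS' hSn'
  have hb := le_soc (b := z.bids) hξ t hlam
    (Lam := fun l => drain z.bids l + max 0 (extraDrain z.bids l - lam)) (fun l s hs0 hs1 => by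
      have hcomb := D.rate_convex_comb hs0 hs1 (z.bids.x0 l) (z.bids.x0 l + z.bids.xu l)
      have e : (1 - s) * z.bids.x0 l + s * (z.bids.x0 l + z.bids.xu l)
          = z.bids.x0 l + s * z.bids.xu l := by ring
      rw [e] at hcomb
      refine le_trans ?_ hcomb
      have h2 := le_max_left 0 (extraDrain z.bids l - lam)
      have h3 := le_max_right 0 (extraDrain z.bids l - lam)
      have h4 : s * (extraDrain z.bids l - lam) ≤ max 0 (extraDrain z.bids l - lam) := by
        nlinarith
      have h5 : D.rate (z.bids.x0 l + z.bids.xu l)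
          = D.rate (z.bids.x0 l) - extraDrain z.bids l := by rw [extraDrain]; ring
      rw [h5, drain]
      linarith)
  rw [hτ, D.sum_mul_elapsed k h0 h1] at hb
  refine le_trans ?_ hb
  rw [Finset.sum_insert hkm] at hend hle'
  rw [Finset.sum_add_distrib, hn]
  -- with the common `lam` the bound is affine in `τ`, so the bounds at both ends suffice
  have e1 := mul_le_mul_of_nonneg_left hle hdt.le
  have e2 := mul_le_mul_of_nonneg_left hle' hdt.le
  nlinarith [mul_le_mul_of_nonneg_left (hstart.trans (sub_le_sub_left
      (mul_le_mul_of_nonneg_left (add_le_add le_rfl hle) hdt.le) _)) (sub_nonneg.2 h1),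
    mul_le_mul_of_nonneg_left (hend.trans (sub_le_sub_left
      (mul_le_mul_of_nonneg_left (add_le_add le_rfl hle') hdt.le) _)) h0]

theorem soc_le_of_finite {z : D.ProgVar} (hz : D.Domains z) (hu : D.UpperSOC z)
    {ξ : D.Horizon → ℝ} (hξ : ξ ∈ D.signals) (t : D.Horizon) :
    D.soc (D.lift z.bids) ξ t ≤ D.yhi := by
  classical
  have hdt := D.dt_pos
  obtain ⟨τ, h0, h1, hτ⟩ := D.exists_eq_add_mul t
  obtain ⟨k, hk⟩ : ∃ k, k = D.idx t := ⟨_, rfl⟩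
  rw [← hk] at hτ
  have hlam := hz.lamHi_nonneg k
  have hxd : ∀ l, 0 ≤ (z.bids.xd l : ℝ) := fun l => (z.bids.xd l).coe_nonneg
  -- intervals after `k` get zero weight, and any majorant will do there
  let Lam : Fin D.K → ℝ := fun l => if h : l ≤ k then z.LamHi k ⟨l, h⟩
    else D.rate (z.bids.x0 l - z.bids.xd l)
  have hmaj : ∀ l, ∀ s : ℝ, 0 ≤ s → s ≤ 1 →
      D.rate (z.bids.x0 l - s * z.bids.xd l) ≤ Lam l + z.lamHi k * s := by
    intro l s hs0 hs1
    rcases lt_trichotomy l k with hlk | rfl | hlk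
    · have hL : Lam l = z.LamHi k ⟨l, hlk.le⟩ := dif_pos hlk.le
      have c1 := hu.off_diag₁ k l hlk
      have c2 := hu.off_diag₂ k l hlk
      have c3 := hu.off_diag₃ k l hlk
      have c4 := hu.off_diag₄ k l hlk
      have c5 := hu.bilinear k l hlk
      have d1 : z.bids.x0 l - z.bids.xd l ≤ z.υ₁ (nonLast hlk) * D.xhi := hu.υ₁_upper (nonLast hlk)
      have d2 : (1 - z.υ₁ (nonLast hlk)) * D.xlo ≤ z.bids.x0 l - z.bids.xd l :=
        hu.υ₁_lower (nonLast hlk)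
      have d3 : z.bids.x0 l ≤ (1 - z.υ₂ (nonLast hlk)) * D.xhi := hu.υ₂_upper (nonLast hlk)
      rw [← hL] at c1 c2 c3 c4 c5
      refine majorant_of_constraints (hxd l) ?_ ?_ (fun hx hy => ?_) hs0 hs1
      · rcases hz.υ₂_binary (nonLast hlk) with h | h
        · rw [h] at c2
          linarith [D.rate_le_discharge (z.bids.x0 l)]
        · rw [h] at c4
          linarith [D.rate_le_charge (z.bids.x0 l)]
      · rcases hz.υ₁_binary (nonLast hlk) with h | h
        · rw [h] at c3
          linarith [D.rate_le_charge (z.bids.x0 l - z.bids.xd l)]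
        · rw [h] at c1
          have e : -((z.bids.x0 l - z.bids.xd l) / D.etaD)
              = (z.bids.xd l - z.bids.x0 l) / D.etaD := by ring
          linarith [D.rate_le_discharge (z.bids.x0 l - z.bids.xd l)]
      · rcases hz.υ₁_binary (nonLast hlk) with h | h
        · rcases hz.υ₂_binary (nonLast hlk) with h' | h'
          · rw [h, h'] at c5
            linarith
          · rw [h'] at d3
            linarith
        · rw [h] at d2
          linarith
    · have hL : Lam l = z.LamHi l ⟨l, le_refl l⟩ := dif_pos le_rfl
      have c1 := hu.diag_charge l
      have c2 := hu.diag_down l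
      rw [← hL] at c1 c2
      refine (D.rate_le_charge _).trans ?_
      nlinarith [mul_le_mul_of_nonneg_left c1 (sub_nonneg.2 hs1),
        mul_le_mul_of_nonneg_left c2 hs0]
    · have hL : Lam l = D.rate (z.bids.x0 l - z.bids.xd l) := dif_neg (not_le.2 hlk)
      rw [hL]
      exact (D.rate_antitone (sub_le_sub_left
        (mul_le_of_le_one_left (hxd l) hs1) _)).trans
          (le_add_of_nonneg_right (mul_nonneg hlam hs0))
  have hdiag : 0 ≤ Lam k := by
    have hL : Lam k = z.LamHi k ⟨k, le_refl k⟩ := dif_pos le_rfl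
    exact hL ▸ hu.diag_nonneg k
  have hsum : ∑ l : Set.Iic k, z.LamHi k l = ∑ l ∈ insert k (Finset.Iio k), Lam l := by
    rw [← D.sum_Iic k Lam]
    refine Finset.sum_congr rfl fun l _ => ?_
    have hL : Lam l = z.LamHi k l := dif_pos (show (l : Fin D.K) ≤ k from l.2)
    exact hL.symm
  have hsoc := hu.soc k
  have hb := soc_le (b := z.bids) hξ t hlam hmaj
  rw [hτ, D.sum_mul_elapsed k h0 h1] at hb
  refine hb.trans (le_trans ?_ hsoc)
  rw [hsum, Finset.sum_insert (by simp)]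
  nlinarith [mul_le_mul_of_nonneg_left (mul_le_of_le_one_left hdiag h1) hdt.le]

theorem robust_feasible_of_finite {z : D.ProgVar} (hγ : ∃ n : ℕ, 0 < n ∧ D.γ = n * D.dt)
    (hy0 : D.ylo ≤ D.y0) (h : z ∈ (D.finiteProblem c φ).feasible) :
    D.lift z.bids ∈ (D.robustProblem c φ).feasible := by
  obtain ⟨hz, hp, hl, hu⟩ := h
  intro t ξ hξ
  have ho := output_le (hξ.2.1 t) (z.bids.x0 (D.idx t)) (z.bids.xu (D.idx t))
    (z.bids.xd (D.idx t))
  exact ⟨(hp.lower _).trans ho.2, ho.1.trans (hp.upper _), le_soc_of_finite hz hl hγ hy0 hξ t,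
    soc_le_of_finite hz hu hξ t⟩

/-! ### Identification of bids and vectors -/

theorem avg_lift (v : D.BidVec) :
    (∀ k, D.avg (D.lift v).x0.1 k = v.x0 k) ∧
    (∀ k, D.avg (fun t => ((D.lift v).xu.1 t : ℝ)) k = v.xu k) ∧
    (∀ k, D.avg (fun t => ((D.lift v).xd.1 t : ℝ)) k = v.xd k) :=
  ⟨fun k => D.avg_comp_idx v.x0 k, fun k => D.avg_comp_idx (fun l => (v.xu l : ℝ)) k,
    fun k => D.avg_comp_idx (fun l => (v.xd l : ℝ)) k⟩

theorem eq_of_values {v w : D.BidVec} (h0 : ∀ k, v.x0 k = w.x0 k)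
    (hu : ∀ k, (v.xu k : ℝ) = w.xu k) (hd : ∀ k, (v.xd k : ℝ) = w.xd k) : v = w := by
  cases v
  cases w
  congr
  · exact funext h0
  · exact funext fun k => NNReal.coe_injective (hu k)
  · exact funext fun k => NNReal.coe_injective (hd k)

theorem lift_injective : Function.Injective D.lift := by
  intro v w h
  obtain ⟨a1, a2, a3⟩ := avg_lift v
  obtain ⟨b1, b2, b3⟩ := avg_lift w
  rw [h] at a1 a2 a3
  exact eq_of_values (fun k => (a1 k).symm.trans (b1 k)) (fun k => (a2 k).symm.trans (b2 k))
    (fun k => (a3 k).symm.trans (b3 k))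

theorem step_surjective {U : Type} (f : D.PiecewiseConst U) : ∃ v, D.step v = f := by
  have hmem : ∀ k : Fin D.K, ∃ t : D.Horizon, t ∈ D.interval k := fun k =>
    ⟨⟨_, D.add_mul_mem k le_rfl zero_le_one⟩, by
      change _ ≤ ((k : ℝ) + 0) * D.dt; rw [add_zero],
      Or.inl (by change ((k : ℝ) + 0) * D.dt < _; nlinarith [D.dt_pos])⟩
  choose t ht using hmem
  exact ⟨fun k => f.1 (t k), Subtype.ext (funext fun s =>
    f.2 (D.idx s) _ (ht _) _ (D.mem_interval_idx s))⟩

theorem lift_bijective : Function.Bijective D.lift := by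
  refine ⟨lift_injective, fun x => ?_⟩
  obtain ⟨v0, h0⟩ := step_surjective x.x0
  obtain ⟨vu, hu⟩ := step_surjective x.xu
  obtain ⟨vd, hd⟩ := step_surjective x.xd
  exact ⟨⟨v0, vu, vd⟩, by rw [lift, h0, hu, hd]⟩

end StorageData

theorem theorem1 (D : StorageData)
    (hγ : ∃ n : ℕ, 0 < n ∧ D.γ = n * D.dt) (hy0 : D.ylo ≤ D.y0)
    (c : D.Bids → EReal) (φ : D.Bids → ℝ → EReal) :
    -- bid vectors and piecewise constant bids are identified, the inverse of `lift` being the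
    -- average over each trading interval
    Function.Bijective D.lift ∧
    (∀ (x : D.Bids) (v : D.BidVec), D.lift v = x ↔
      (∀ k, v.x0 k = D.avg x.x0.1 k) ∧
      (∀ k, (v.xu k : ℝ) = D.avg (fun t => (x.xu.1 t : ℝ)) k) ∧
      (∀ k, (v.xd k : ℝ) = D.avg (fun t => (x.xd.1 t : ℝ)) k)) ∧
    -- the feasible bids coincide
    (∀ x : D.Bids, x ∈ (D.robustProblem c φ).feasible ↔
      ∃ z ∈ (D.finiteProblem c φ).feasible, D.lift z.bids = x) ∧
    -- and they also coincide when the multipliers of the upper-SOC constraints are bounded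
    (∀ x : D.Bids, x ∈ (D.robustProblem c φ).feasible ↔
      ∃ z ∈ (D.finiteProblem c φ).feasible, D.lift z.bids = x ∧
        ∀ k, z.lamHi k ≤ (D.xhi - D.xlo) / D.etaD) ∧
    -- the objectives, the optimal values and the optimal bids agree
    (∀ z : D.ProgVar,
      (D.finiteProblem c φ).cost z = (D.robustProblem c φ).cost (D.lift z.bids)) ∧
    (D.robustProblem c φ).value = (D.finiteProblem c φ).value ∧
    (∀ z ∈ (D.finiteProblem c φ).feasible,
      (D.finiteProblem c φ).IsOptimal z ↔ (D.robustProblem c φ).IsOptimal (D.lift z.bids)) ∧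
    (∀ x : D.Bids, (D.robustProblem c φ).IsOptimal x ↔
      ∃ z, (D.finiteProblem c φ).IsOptimal z ∧ D.lift z.bids = x) := by
  have hto : ∀ z ∈ (D.finiteProblem c φ).feasible,
      D.lift z.bids ∈ (D.robustProblem c φ).feasible := fun z hz =>
    StorageData.robust_feasible_of_finite hγ hy0 hz
  have hfrom : ∀ x ∈ (D.robustProblem c φ).feasible,
      ∃ z ∈ (D.finiteProblem c φ).feasible, D.lift z.bids = x ∧
        ∀ k, z.lamHi k ≤ (D.xhi - D.xlo) / D.etaD := by
    intro x hx
    obtain ⟨v, rfl⟩ := StorageData.lift_bijective.2 x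
    obtain ⟨z, hz, rfl, hlam⟩ := StorageData.exists_finite_feasible hγ hx
    exact ⟨z, hz, rfl, hlam⟩
  have hcost : ∀ z : D.ProgVar,
      (D.finiteProblem c φ).cost z = (D.robustProblem c φ).cost (D.lift z.bids) := fun _ => rfl
  have hopt : ∀ z ∈ (D.finiteProblem c φ).feasible,
      (D.finiteProblem c φ).IsOptimal z ↔ (D.robustProblem c φ).IsOptimal (D.lift z.bids) := by
    refine fun z hz => ⟨fun h => ⟨hto z hz, fun x hx => ?_⟩,
      fun h => ⟨hz, fun z' hz' => h.2 _ (hto z' hz')⟩⟩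
    obtain ⟨z', hz', rfl, -⟩ := hfrom x hx
    exact h.2 z' hz'
  refine ⟨StorageData.lift_bijective, fun x v => ⟨?_, ?_⟩, fun x => ⟨fun hx => ?_, ?_⟩,
    fun x => ⟨hfrom x, ?_⟩, hcost, le_antisymm ?_ ?_, hopt, fun x => ⟨fun hx => ?_, ?_⟩⟩
  · rintro rfl
    obtain ⟨h1, h2, h3⟩ := StorageData.avg_lift v
    exact ⟨fun k => (h1 k).symm, fun k => (h2 k).symm, fun k => (h3 k).symm⟩
  · rintro ⟨h1, h2, h3⟩
    obtain ⟨w, rfl⟩ := StorageData.lift_bijective.2 x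
    obtain ⟨g1, g2, g3⟩ := StorageData.avg_lift w
    rw [StorageData.eq_of_values (fun k => (h1 k).trans (g1 k)) (fun k => (h2 k).trans (g2 k))
      (fun k => (h3 k).trans (g3 k))]
  · obtain ⟨z, hz, h, -⟩ := hfrom x hx
    exact ⟨z, hz, h⟩
  · rintro ⟨z, hz, rfl⟩
    exact hto z hz
  · rintro ⟨z, hz, rfl, -⟩
    exact hto z hz
  · exact le_iInf₂ fun z hz => iInf₂_le (D.lift z.bids) (hto z hz)
  · refine le_iInf₂ fun x hx => ?_
    obtain ⟨z, hz, rfl, -⟩ := hfrom x hx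
    exact iInf₂_le z hz
  · obtain ⟨z, hz, rfl, -⟩ := hfrom x hx.1
    exact ⟨z, (hopt z hz).2 hx, rfl⟩
  · rintro ⟨z, hz, rfl⟩
    exact (hopt z hz.1).1 hz
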